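/- Let $M$ be a smooth manifold (finite-dimensional, Hausdorff, second countable, without boundary). A closed cone field on $M$ is a subset $\mathcal C\subset TM$ such that $\mathcal C\cup T^0M$ is closed in $TM$ (where $T^0M$ is the zero section) and such that each fibre $\mathcal C(x)=\mathcal C\cap T_xM$ is a convex cone, that is, a possibly empty convex set, stable under multiplication by positive reals and contained in an open half space $\{l>0\}$, $l\in T_x^*M$. Its domain is $\mathcal D=\{x:\mathcal C(x)\neq\emptyset\}$. A causal curve is a locally Lipschitz map $\gamma:I\to M$ on a non-empty interval $I\subset\mathbb R$ with $\dot\gamma(t)\in\mathcal C(\gamma(t))$ for almost every $t\in I$; if $I$ is a single point one requires instead that the value of $\gamma$ lies in $\mathcal D$. It is inextensible if neither $\gamma$ nor any increasing reparametrization of $\gamma$ is the restriction of a causal curve defined on a strictly larger interval. Write $y\in\mathcal J^+(x)$, equivalently $x\in\mathcal J^-(y)$, if there are $T\ge 0$ and a causal curve $\gamma:[0,T]\to M$ with $\gamma(0)=x$, $\gamma(T)=y$; write $y\in\mathcal J^{++}(x)$ if this is possible with $T>0$; put $\mathcal J^\pm(A)=\bigcup_{x\in A}\mathcal J^\pm(x)$.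 The field $\mathcal C$ is locally solvable if for each $x\in\mathcal D$ there is a nonconstant causal curve $\gamma:\,]-1,1[\,\to M$ with $\gamma(0)=x$. It is globally hyperbolic if it is locally solvable, $x\notin\mathcal J^{++}(x)$ for each $x\in M$, and $\mathcal J^+(K)\cap\mathcal J^-(K')$ is compact for all compact sets $K,K'\subset M$. A subset $H\subset M$ is a Cauchy subset if there are a neighborhood $\tilde M$ of $\mathcal D$ and relatively open sets $U^+,U^-$ of $\tilde M$ such that $\tilde M$ is the disjoint union of $U^+$, $U^-$ and $\tilde M\cap H$ (some of which may be empty), and such that for each inextensible causal curve $\gamma:\mathbb R\to M$ there are real numbers $a\le b$ with $\gamma(]-\infty,a[)\subset U^-$, $\gamma([a,b])\subset H$ and $\gamma(]b,\infty[)\subset U^+$. A Cauchy causal function is a continuous function $\tau:M\to\mathbb R$ such that $\tau\circ\gamma$ is nondecreasing for each causal curve $\gamma$ and $\tau\circ\gamma:I\to\mathbb R$ is onto for each inextensible causal curve $\gamma:I\to M$. **Proposition.** Let $\mathcal C$ be a closed cone field on $M$. 1. If $\mathcal C$ is locally solvable and admits a Cauchy subset, then $\mathcal C$ is globally hyperbolic.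 2. If there exists a Cauchy causal function for $\mathcal C$ (local solvability not being assumed), then $\mathcal C$ is globally hyperbolic. -/

import Mathlib

open Set Filter MeasureTheory
open scoped Topology Manifold ContDiff

/-- A convex cone of a real vector space: a (possibly empty) convex set, stable under
multiplication by positive reals and contained in an open half space `{v | 0 < l v}`. -/
structure IsOpenHalfSpaceCone {V : Type*} [AddCommGroup V] [Module ℝ V] (S : Set V) : Prop where
  convex : Convex ℝ S
  smul_mem : ∀ t : ℝ, 0 < t → ∀ v ∈ S, t • v ∈ S
  halfSpace : ∃ l : V →ₗ[ℝ] ℝ, ∀ v ∈ S, 0 < l v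

namespace ConeField

section

variable {E : Type*} [NormedAddCommGroup E] [NormedSpace ℝ E]
  {M : Type*} [TopologicalSpace M] [ChartedSpace E M]

/-- The fibre `C(x) = C ∩ T_x M` of a subset `C` of the tangent bundle. -/
def fiber (C : Set (TangentBundle 𝓘(ℝ, E) M)) (x : M) : Set (TangentSpace 𝓘(ℝ, E) x) :=
  {v | (⟨x, v⟩ : TangentBundle 𝓘(ℝ, E) M) ∈ C}

/-- A closed cone field: every fibre is a convex cone, and the union of `C` with the zero section
is closed in `TM`. -/
structure IsClosedConeField [IsManifold 𝓘(ℝ, E) ∞ M]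
    (C : Set (TangentBundle 𝓘(ℝ, E) M)) : Prop where
  cone : ∀ x : M, IsOpenHalfSpaceCone (fiber C x)
  closed : IsClosed (C ∪ {p : TangentBundle 𝓘(ℝ, E) M | p.2 = 0})

/-- The domain of `C`: the points at which the fibre is not empty. -/
def domain (C : Set (TangentBundle 𝓘(ℝ, E) M)) : Set M :=
  {x | (fiber C x).Nonempty}

variable (E) in
/-- The curve `γ`, restricted to `I`, is locally Lipschitz: it is continuous, and Lipschitz near
each time when it is read in a chart. -/
def IsLocallyLipschitzCurve (I : Set ℝ) (γ : ℝ → M) : Prop :=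
  ContinuousOn γ I ∧ ∀ t ∈ I, ∃ K : NNReal, ∃ u ∈ 𝓝[I] t,
    LipschitzOnWith K (fun s => extChartAt 𝓘(ℝ, E) (γ t) (γ s)) u

/-- `γ : I → M` is a causal curve, where `I` is a non-empty interval (only the values of `γ` on `I`
matter). For an interval reduced to a point the condition on the velocity is void, and it is
required instead that the point of `M` lies in the domain. -/
structure IsCausalCurve (C : Set (TangentBundle 𝓘(ℝ, E) M)) (I : Set ℝ) (γ : ℝ → M) : Prop where
  nonempty : I.Nonempty
  ordConnected : I.OrdConnected
  locallyLipschitz : IsLocallyLipschitzCurve E I γ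
  velocity : ∀ᵐ t ∂(volume.restrict I), MDifferentiableWithinAt 𝓘(ℝ, ℝ) 𝓘(ℝ, E) γ I t ∧
    (mfderivWithin 𝓘(ℝ, ℝ) 𝓘(ℝ, E) γ I t 1 : TangentSpace 𝓘(ℝ, E) (γ t)) ∈ fiber C (γ t)
  trivial : I.Subsingleton → ∀ t ∈ I, γ t ∈ domain C

/-- The causal future `J⁺(x)`. -/
def future (C : Set (TangentBundle 𝓘(ℝ, E) M)) (x : M) : Set M :=
  {y | ∃ T : ℝ, 0 ≤ T ∧ ∃ γ : ℝ → M, IsCausalCurve C (Icc 0 T) γ ∧ γ 0 = x ∧ γ T = y}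

/-- The strictly causal future `J⁺⁺(x)`. -/
def strictFuture (C : Set (TangentBundle 𝓘(ℝ, E) M)) (x : M) : Set M :=
  {y | ∃ T : ℝ, 0 < T ∧ ∃ γ : ℝ → M, IsCausalCurve C (Icc 0 T) γ ∧ γ 0 = x ∧ γ T = y}

/-- The causal past `J⁻(x)`. -/
def past (C : Set (TangentBundle 𝓘(ℝ, E) M)) (x : M) : Set M :=
  {y | x ∈ future C y}

/-- The causal future `J⁺(A)` of a set. -/
def futureOf (C : Set (TangentBundle 𝓘(ℝ, E) M)) (A : Set M) : Set M :=
  ⋃ x ∈ A, future C x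

/-- The causal past `J⁻(A)` of a set. -/
def pastOf (C : Set (TangentBundle 𝓘(ℝ, E) M)) (A : Set M) : Set M :=
  ⋃ x ∈ A, past C x

/-- Local solvability: through each point of the domain passes a nonconstant causal curve
`]-1, 1[ → M` at time `0`. -/
def IsLocallySolvable (C : Set (TangentBundle 𝓘(ℝ, E) M)) : Prop :=
  ∀ x ∈ domain C, ∃ γ : ℝ → M, IsCausalCurve C (Ioo (-1) 1) γ ∧ γ 0 = x ∧
    ∃ s ∈ Ioo (-1 : ℝ) 1, ∃ t ∈ Ioo (-1 : ℝ) 1, γ s ≠ γ t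

/-- `C` is causal: there is no closed nontrivial causal curve. -/
def IsCausal (C : Set (TangentBundle 𝓘(ℝ, E) M)) : Prop :=
  ∀ x : M, x ∉ strictFuture C x

/-- `C` is hyperbolic. -/
def IsHyperbolic (C : Set (TangentBundle 𝓘(ℝ, E) M)) : Prop :=
  IsCausal C ∧ ∀ K K' : Set M, IsCompact K → IsCompact K' →
    IsCompact (futureOf C K ∩ pastOf C K')

/-- `C` is globally hyperbolic. -/
def IsGloballyHyperbolic (C : Set (TangentBundle 𝓘(ℝ, E) M)) : Prop :=
  IsHyperbolic C ∧ IsLocallySolvable C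

/-- The causal curve `γ : I → M` is inextensible: neither `γ` nor an increasing reparametrization
of `γ` is the restriction of a causal curve `γ' : I' → M` to an interval `φ(I)` strictly smaller
than `I'`. Reparametrizations have to be allowed, since otherwise every causal curve that is
defined on `ℝ` would be inextensible, even if it has limits in `M` at `±∞`. -/
def IsInextensible (C : Set (TangentBundle 𝓘(ℝ, E) M)) (I : Set ℝ) (γ : ℝ → M) : Prop :=
  IsCausalCurve C I γ ∧ ¬ ∃ (I' : Set ℝ) (γ' : ℝ → M) (φ : ℝ → ℝ),
    IsCausalCurve C I' γ' ∧ ContinuousOn φ I ∧ StrictMonoOn φ I ∧ φ '' I ⊂ I' ∧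
      ∀ t ∈ I, γ' (φ t) = γ t

/-- `H` is a Cauchy subset: a neighbourhood `N` of the domain is the disjoint union of two
relatively open sets `U⁺`, `U⁻` and of `N ∩ H`, and each inextensible causal curve `ℝ → M` is
first in `U⁻`, then in `H` during a compact non-empty time interval, then in `U⁺`. -/
def IsCauchySubset (C : Set (TangentBundle 𝓘(ℝ, E) M)) (H : Set M) : Prop :=
  ∃ N ∈ 𝓝ˢ (domain C), ∃ Uplus Uminus : Set M,
    (∃ O, IsOpen O ∧ Uplus = N ∩ O) ∧ (∃ O, IsOpen O ∧ Uminus = N ∩ O) ∧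
    Uplus ∪ Uminus ∪ (N ∩ H) = N ∧
    Disjoint Uplus Uminus ∧ Disjoint Uplus (N ∩ H) ∧ Disjoint Uminus (N ∩ H) ∧
    ∀ γ : ℝ → M, IsInextensible C univ γ → ∃ a b : ℝ, a ≤ b ∧
      (∀ t < a, γ t ∈ Uminus) ∧ (∀ t > b, γ t ∈ Uplus) ∧ ∀ t ∈ Icc a b, γ t ∈ H

/-- A causal function: continuous, and nondecreasing along each causal curve. -/
def IsCausalFunction (C : Set (TangentBundle 𝓘(ℝ, E) M)) (τ : M → ℝ) : Prop :=
  Continuous τ ∧ ∀ (I : Set ℝ) (γ : ℝ → M), IsCausalCurve C I γ →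
    MonotoneOn (fun t => τ (γ t)) I

/-- A Cauchy causal function: a causal function that is onto `ℝ` along each inextensible causal
curve. -/
def IsCauchyCausalFunction (C : Set (TangentBundle 𝓘(ℝ, E) M)) (τ : M → ℝ) : Prop :=
  IsCausalFunction C τ ∧ ∀ (I : Set ℝ) (γ : ℝ → M), IsInextensible C I γ →
    SurjOn (fun t => τ (γ t)) I univ

end

end ConeField

/-! The engine is a limit curve argument. Around each point there is a chart ball (`ChartBox`) on
which a linear form bounds the norm of every cone vector. Inside it a causal curve is a 1-Lipschitz
graph over that form, and such graphs have pointwise limits along ultrafilters. The velocity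
condition is encoded in `IsConeGraph` without derivatives: linear forms that are nonnegative on the
nearby cones increase along the curve. This survives limits, and Hahn-Banach recovers the velocity
from it (`IsConeGraph.mem_of_hasDerivAt`).

Given causal curves whose origins converge to `x`, one follows them from box to box, always in the
first box of a fixed countable cover. Either their endpoints converge to a point of the future of
`x`, or infinitely many full steps are made in the limit (`limit_or_isStepSeq`). The vertices of
such steps cannot converge (`IsStepSeq.not_tendsto`), so they lie on a ray that cannot be extended.

A Cauchy subset yields sets `P` and `F`, open relative to the domain, such that inextensible curves
start in `P` and end in `F`, and no causal curve goes from `F` to `P`. If the forward limit fails,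
the limit ray enters `F`, hence so do the approximating curves. If the backward limit from the other
end fails, the curves visit `P`. Failing forward up to an intermediate time and backward down to it
would give `F` before `P`, which is impossible. So intermediate points converge (`exists_tendsto`),
and the same dichotomy shows that the causal relation is closed (`mem_future_of_tendsto`). Together
these give compactness. A closed causal curve, run forever in both directions, would put a point in
both `P` and `F`.

For a Cauchy causal function, the zero level is a Cauchy subset. Local solvability follows because
an inextensible curve through `x` takes values of the function above and below its value at `x`, so
`x` is not an endpoint. -/

theorem le_of_ae_deriv_nonneg {g : ℝ → ℝ} {a b : ℝ} (hab : a ≤ b)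
    (hg : LocallyLipschitzOn (Icc a b) g) (hd : ∀ᵐ t, t ∈ Ioo a b → 0 ≤ deriv g t) :
    g a ≤ g b := by
  obtain ⟨K, hK⟩ := hg.exists_lipschitzOnWith_of_compact isCompact_Icc
  have hac : AbsolutelyContinuousOnInterval g a b := by
    apply LipschitzOnWith.absolutelyContinuousOnInterval (K := K)
    rwa [uIcc_of_le hab]
  have h := hac.integral_deriv_eq_sub
  have : 0 ≤ ∫ t in a..b, deriv g t := by
    rw [intervalIntegral.integral_of_le hab, integral_Ioc_eq_integral_Ioo]
    apply setIntegral_nonneg_of_ae_restrict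
    exact (ae_restrict_iff' measurableSet_Ioo).2 hd
  linarith

/-! ### Cones in a normed space: graphs, their limits and their velocities. -/

section ConeGraph

variable {E : Type*} [NormedAddCommGroup E] [NormedSpace ℝ E]

/-- A field of convex cones on a normed space, closed over `U` up to the zero section. -/
structure IsClosedConeOn (Γ : Set (E × E)) (U : Set E) : Prop where
  convex : ∀ y, Convex ℝ {w | (y, w) ∈ Γ}
  smul_mem : ∀ y w, ∀ t : ℝ, 0 < t → (y, w) ∈ Γ → (y, t • w) ∈ Γ
  halfSpace : ∀ y, ∃ l : E →L[ℝ] ℝ, ∀ w, (y, w) ∈ Γ → 0 < l w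
  closed : ∀ y ∈ U, ∀ w, w ≠ 0 → (y, w) ∈ closure Γ → (y, w) ∈ Γ

/-- Compactness of the unit sphere: normalized counterexamples over base points tending to `y₀`
accumulate at a unit vector of the cone at `y₀` where `n` is nonpositive. The positivity hypothesis
is vacuous over an empty fibre, and then any `n` is allowed. -/
theorem IsClosedConeOn.exists_ball_norm_le [FiniteDimensional ℝ E] {Γ : Set (E × E)} {U : Set E}
    (hΓ : IsClosedConeOn Γ U) {y₀ : E} (hy₀ : y₀ ∈ U) (n : E →L[ℝ] ℝ)
    (hn : ∀ w, (y₀, w) ∈ Γ → 0 < n w) :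
    ∃ r > 0, ∃ K > 0, ∀ q ∈ Γ, q.1 ∈ Metric.ball y₀ r → ‖q.2‖ ≤ K * n q.2 := by
  by_contra! H
  have H' : ∀ k : ℕ, ∃ q ∈ Γ, q.1 ∈ Metric.ball y₀ (1 / (k + 1)) ∧
      (k + 1 : ℝ) * n q.2 < ‖q.2‖ := fun k => by
    obtain ⟨q, h1, h2, h3⟩ := H (1 / (k + 1)) (by positivity) (k + 1) (by positivity)
    exact ⟨q, h1, h2, h3⟩
  choose q hqΓ hqb hqn using H'
  have hq0 : ∀ k, (q k).2 ≠ 0 := fun k h0 => by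
    have := hqn k
    simp [h0] at this
  have hpos : ∀ k, 0 < ‖(q k).2‖ := fun k => norm_pos_iff.2 (hq0 k)
  let u : ℕ → E := fun k => ‖(q k).2‖⁻¹ • (q k).2
  have hu : ∀ k, u k ∈ Metric.sphere (0 : E) 1 := fun k => by
    simp [u, norm_smul, (hpos k).ne']
  have : ProperSpace E := FiniteDimensional.proper_real E
  obtain ⟨v, hv, φ, hφ, hlim⟩ := (isCompact_sphere (0 : E) 1).tendsto_subseq hu
  have hv1 : ‖v‖ = 1 := by simpa using hv
  have hv0 : v ≠ 0 := by
    rintro rfl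
    simp at hv1
  have h1k : Tendsto (fun k : ℕ => 1 / ((k : ℝ) + 1)) atTop (𝓝 0) :=
    tendsto_one_div_add_atTop_nhds_zero_nat
  have hq1 : Tendsto (fun k => (q k).1) atTop (𝓝 y₀) := by
    rw [tendsto_iff_dist_tendsto_zero]
    exact squeeze_zero (fun _ => dist_nonneg) (fun k => (Metric.mem_ball.1 (hqb k)).le) h1k
  have hmem : (y₀, v) ∈ closure Γ := by
    refine mem_closure_of_tendsto ((hq1.comp hφ.tendsto_atTop).prodMk_nhds hlim)
      (Eventually.of_forall fun k => ?_)
    exact hΓ.smul_mem _ _ _ (inv_pos.2 (hpos (φ k))) (hqΓ (φ k))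
  have hpos' := hn v (hΓ.closed y₀ hy₀ v hv0 hmem)
  have hle : n v ≤ 0 := by
    refine le_of_tendsto_of_tendsto ((n.continuous.tendsto v).comp hlim)
      (h1k.comp hφ.tendsto_atTop) (Eventually.of_forall fun k => ?_)
    have h2 := hqn (φ k)
    have h3 := hpos (φ k)
    simp only [Function.comp_apply, u, map_smul, smul_eq_mul]
    rw [inv_mul_le_iff₀ h3, mul_one_div, le_div_iff₀ (by positivity)]
    linarith
  linarith

/-- Curves `[0, h] → E` parametrized by a linear form `l` with `‖w‖ ≤ l w` for the admissible
velocities `w`, whose velocities are admissible in a weak sense. -/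
structure IsConeGraph (Γ : Set (E × E)) (l : E →L[ℝ] ℝ) (h : ℝ) (c : ℝ → E) : Prop where
  height : ∀ s ∈ Icc 0 h, l (c s) = l (c 0) + s
  lipschitz : ∀ s ∈ Icc 0 h, ∀ t ∈ Icc 0 h, ‖c s - c t‖ ≤ |s - t|
  mono : ∀ (n : E →L[ℝ] ℝ) (z : E) (r : ℝ),
    (∀ q ∈ Γ, q.1 ∈ Metric.ball z (2 * r) → 0 ≤ n q.2) →
    ∀ s t, 0 ≤ s → s ≤ t → t ≤ h → t - s ≤ r → c s ∈ Metric.ball z r → n (c s) ≤ n (c t)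

theorem isConeGraph_zero (Γ : Set (E × E)) (l : E →L[ℝ] ℝ) (x : E) :
    IsConeGraph Γ l 0 (fun _ => x) where
  height s hs := by
    have : s = 0 := le_antisymm hs.2 hs.1
    simp [this]
  lipschitz s _ t _ := by simp
  mono _ _ _ _ _ _ _ _ _ _ _ := le_rfl

theorem IsConeGraph.norm_sub_le {Γ : Set (E × E)} {l : E →L[ℝ] ℝ} {h : ℝ} {c : ℝ → E}
    (hc : IsConeGraph Γ l h c) {s : ℝ} (hs : s ∈ Icc 0 h) : ‖c s - c 0‖ ≤ s := by
  have := hc.lipschitz s hs 0 ⟨le_rfl, hs.1.trans hs.2⟩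
  simpa [abs_of_nonneg hs.1] using this

/-- All three fields of `IsConeGraph` involve only values of the curve, so they pass to pointwise
limits. The ultrafilter replaces Arzelà-Ascoli: values at a given time stay in a compact ball. -/
theorem IsConeGraph.exists_limit [FiniteDimensional ℝ E] {Γ : Set (E × E)} {l : E →L[ℝ] ℝ}
    {ι : Type*} (𝒰 : Ultrafilter ι) {h : ι → ℝ} {c : ι → ℝ → E} {H : ℝ} {x : E}
    (h0 : ∀ᶠ i in 𝒰, 0 ≤ h i) (hg : ∀ᶠ i in 𝒰, IsConeGraph Γ l (h i) (c i))
    (hh : Tendsto h 𝒰 (𝓝 H)) (hx : Tendsto (fun i => c i 0) 𝒰 (𝓝 x)) :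
    ∃ c' : ℝ → E, IsConeGraph Γ l H c' ∧ c' 0 = x ∧
      Tendsto (fun i => c i (h i)) 𝒰 (𝓝 (c' H)) := by
  have : ProperSpace E := FiniteDimensional.proper_real E
  have hH : 0 ≤ H := ge_of_tendsto hh h0
  -- The lengths `h i` vary, so times are truncated at `h i`; for `s ≤ H` the truncated times tend
  -- to `s`.
  have hlim : ∀ s : ℝ, ∃ y, 0 ≤ s → Tendsto (fun i => c i (min s (h i))) 𝒰 (𝓝 y) := by
    intro s
    by_cases hs : 0 ≤ s
    swap
    · exact ⟨0, fun h => absurd h hs⟩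
    have hev : ∀ᶠ i in 𝒰, c i (min s (h i)) ∈ Metric.closedBall x (1 + s) := by
      filter_upwards [h0, hg, hx (Metric.ball_mem_nhds x one_pos)] with i hi hgi hxi
      have h1 := hgi.norm_sub_le (s := min s (h i)) ⟨le_min hs hi, min_le_right _ _⟩
      rw [Metric.mem_closedBall, dist_eq_norm]
      have h2 : ‖c i 0 - x‖ < 1 := by simpa [dist_eq_norm] using hxi
      have h3 := norm_sub_le_norm_sub_add_norm_sub (c i (min s (h i))) (c i 0) x
      have h4 := min_le_left s (h i)
      linarith
    obtain ⟨y, _, hy⟩ := (isCompact_closedBall x (1 + s)).ultrafilter_le_nhds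
      (𝒰.map fun i => c i (min s (h i))) (by rw [le_principal_iff]; exact hev)
    exact ⟨y, fun _ => hy⟩
  choose c' hc' using hlim
  have hmin : ∀ s, s ≤ H → Tendsto (fun i => min s (h i)) 𝒰 (𝓝 s) := fun s hs => by
    simpa [min_eq_left hs] using (tendsto_const_nhds (x := s)).min hh
  have hc0 : c' 0 = x := by
    refine tendsto_nhds_unique (hc' 0 le_rfl) (hx.congr' ?_)
    filter_upwards [h0] with i hi
    rw [min_eq_left hi]
  refine ⟨c', ⟨?_, ?_, ?_⟩, hc0, ?_⟩
  · intro s hs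
    refine tendsto_nhds_unique ((l.continuous.tendsto _).comp (hc' s hs.1)) ?_
    rw [hc0]
    refine (((l.continuous.tendsto _).comp hx).add (hmin s hs.2)).congr' ?_
    filter_upwards [h0, hg] with i hi hgi
    exact (hgi.height _ ⟨le_min hs.1 hi, min_le_right _ _⟩).symm
  · intro s hs t ht
    refine le_of_tendsto_of_tendsto (((hc' s hs.1).sub (hc' t ht.1)).norm)
      (((hmin s hs.2).sub (hmin t ht.2)).abs) ?_
    filter_upwards [h0, hg] with i hi hgi
    exact hgi.lipschitz _ ⟨le_min hs.1 hi, min_le_right _ _⟩ _ ⟨le_min ht.1 hi, min_le_right _ _⟩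
  · intro n z r hn s t hs hst htH htr hz
    refine le_of_tendsto_of_tendsto ((n.continuous.tendsto _).comp (hc' s hs))
      ((n.continuous.tendsto _).comp (hc' t (hs.trans hst))) ?_
    filter_upwards [h0, hg, hc' s hs (Metric.isOpen_ball.mem_nhds hz)] with i hi hgi hzi
    refine hgi.mono n z r hn _ _ (le_min hs hi) (min_le_min_right _ hst) (min_le_right _ _) ?_ hzi
    rcases le_total s (h i) with h1 | h1
    · rw [min_eq_left h1]
      linarith [min_le_left t (h i)]
    · rw [min_eq_right h1, min_eq_right (h1.trans hst)]
      linarith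
  · rw [tendsto_iff_norm_sub_tendsto_zero]
    have h1 : Tendsto (fun i => |h i - min H (h i)| + ‖c i (min H (h i)) - c' H‖) 𝒰 (𝓝 0) := by
      have := ((hh.sub (hmin H le_rfl)).abs).add
        (tendsto_iff_norm_sub_tendsto_zero.1 (hc' H hH))
      simpa using this
    refine squeeze_zero' (Eventually.of_forall fun _ => norm_nonneg _) ?_ h1
    filter_upwards [h0, hg] with i hi hgi
    refine (norm_sub_le_norm_sub_add_norm_sub _ (c i (min H (h i))) _).trans ?_
    gcongr
    exact hgi.lipschitz _ ⟨hi, le_rfl⟩ _ ⟨le_min hH hi, min_le_right _ _⟩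

/-- A derivative outside the closed convex cone would be separated from it by a linear form. Tilting
that form by `l` makes it positive on the nonzero vectors of the cone, hence on the cones over a
neighbourhood, so it increases along the curve, contrary to its value on the derivative. -/
theorem IsConeGraph.mem_of_hasDerivAt [FiniteDimensional ℝ E] {Γ : Set (E × E)} {U : Set E}
    (hΓ : IsClosedConeOn Γ U) {l : E →L[ℝ] ℝ} {h : ℝ} {c : ℝ → E} (hc : IsConeGraph Γ l h c)
    {s : ℝ} (hs : s ∈ Ioo 0 h) (hU : c s ∈ U) (hl : ∀ w, (c s, w) ∈ Γ → ‖w‖ ≤ l w)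
    {v : E} (hv : HasDerivAt c v s) : (c s, v) ∈ Γ := by
  have hlv : l v = 1 := by
    have h1 : HasDerivAt (fun t => l (c t)) (l v) s := l.hasFDerivAt.comp_hasDerivAt s hv
    have h2 : HasDerivAt (fun t => l (c 0) + t) 1 s := (hasDerivAt_id s).const_add _
    refine h1.unique (h2.congr_of_eventuallyEq ?_)
    filter_upwards [Ioo_mem_nhds hs.1 hs.2] with t ht
    exact hc.height t ⟨ht.1.le, ht.2.le⟩
  have hv0 : v ≠ 0 := by
    rintro rfl
    simp at hlv
  have hΓ0 : ∀ w, (c s, w) ∈ Γ → w ≠ 0 := by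
    rintro w hw rfl
    obtain ⟨m, hm⟩ := hΓ.halfSpace (c s)
    simpa using hm 0 hw
  by_contra hmem
  let S : Set E := {w | (c s, w) ∈ Γ} ∪ {0}
  have hScl : IsClosed S := by
    refine isClosed_of_closure_subset fun w hw => ?_
    by_cases hw0 : w = 0
    · exact Or.inr hw0
    left
    refine hΓ.closed _ hU w hw0 ?_
    have h1 : w ∈ closure {w | (c s, w) ∈ Γ} := by
      rw [closure_union, closure_singleton] at hw
      exact hw.resolve_right hw0
    exact map_mem_closure (f := fun w => (c s, w)) (by fun_prop) h1 fun w hw => hw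
  have hSconv : Convex ℝ S := by
    rw [convex_iff_forall_pos]
    rintro u hu w hw a b ha hb hab
    rcases hu with hu | hu <;> rcases hw with hw | hw
    · exact Or.inl (hΓ.convex (c s) hu hw ha.le hb.le hab)
    · rw [mem_singleton_iff.1 hw, smul_zero, add_zero]
      exact Or.inl (hΓ.smul_mem _ _ _ ha hu)
    · rw [mem_singleton_iff.1 hu, smul_zero, zero_add]
      exact Or.inl (hΓ.smul_mem _ _ _ hb hw)
    · right
      rw [mem_singleton_iff.1 hu, mem_singleton_iff.1 hw]
      simp
  have hvS : v ∉ S := by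
    rintro (h1 | h1)
    exacts [hmem h1, hv0 h1]
  obtain ⟨m, u, hmS, hmv⟩ := geometric_hahn_banach_closed_point hSconv hScl hvS
  have hu : 0 < u := by simpa using hmS 0 (Or.inr rfl)
  have hm0 : ∀ w, (c s, w) ∈ Γ → m w ≤ 0 := by
    intro w hw
    by_contra! hpos
    have := hmS _ (Or.inl (hΓ.smul_mem _ _ (u / m w) (by positivity) hw))
    rw [map_smul, smul_eq_mul, div_mul_cancel₀ _ hpos.ne'] at this
    exact lt_irrefl _ this
  -- `m` is only nonpositive on the cone; adding `u • l` makes `u • l - m` strictly positive there,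
  -- while its value on `v` is `u - m v < 0` because `l v = 1`.
  obtain ⟨r, hr, K, hK, hrK⟩ := hΓ.exists_ball_norm_le hU (u • l - m) (fun w hw => by
    have h1 := norm_pos_iff.2 (hΓ0 w hw)
    have h2 := hl w hw
    have h3 := hm0 w hw
    have h4 : 0 < u * l w := mul_pos hu (by linarith)
    simp only [sub_apply, smul_apply, smul_eq_mul]
    linarith)
  have hder : HasDerivAt (fun t => (u • l - m) (c t)) ((u • l - m) v) s :=
    (u • l - m).hasFDerivAt.comp_hasDerivAt s hv
  have hnn : 0 ≤ (u • l - m) v := by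
    refine ge_of_tendsto (hasDerivWithinAt_iff_tendsto_slope' (s := Ioi s) (by simp) |>.1
      hder.hasDerivWithinAt) ?_
    have hlt : s < min h (s + r / 2) := lt_min hs.2 (by linarith)
    filter_upwards [Ioo_mem_nhdsGT hlt] with t ht
    have h2 := hc.mono (u • l - m) (c s) (r / 2) (fun q hq hqb => by
      have h3 := hrK q hq (by rwa [mul_div_cancel₀ _ two_ne_zero] at hqb)
      have h4 := norm_nonneg q.2
      by_contra! h5
      have h6 := mul_neg_of_pos_of_neg hK h5
      linarith) s t hs.1.le ht.1.le (ht.2.le.trans (min_le_left _ _))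
      (by linarith [ht.2.le.trans (min_le_right _ _)]) (Metric.mem_ball_self (by linarith))
    rw [slope_def_field]
    exact div_nonneg (by linarith) (by linarith [ht.1])
  simp only [sub_apply, smul_apply, smul_eq_mul, hlv] at hnn
  linarith

end ConeGraph

/-! ### Cone fields and velocities read in charts. -/

namespace ConeField

section Charts

variable {E : Type*} [NormedAddCommGroup E] [NormedSpace ℝ E]
  {M : Type*} [TopologicalSpace M] [ChartedSpace E M]

/-- The cone field obtained by reversing all directions. -/
def reversed (C : Set (TangentBundle 𝓘(ℝ, E) M)) : Set (TangentBundle 𝓘(ℝ, E) M) :=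
  {p | (⟨p.1, -p.2⟩ : TangentBundle 𝓘(ℝ, E) M) ∈ C}

theorem mem_fiber_reversed {C : Set (TangentBundle 𝓘(ℝ, E) M)} {x : M}
    {v : TangentSpace 𝓘(ℝ, E) x} : v ∈ fiber (reversed C) x ↔ -v ∈ fiber C x := Iff.rfl

theorem reversed_reversed (C : Set (TangentBundle 𝓘(ℝ, E) M)) : reversed (reversed C) = C := by
  ext ⟨x, v⟩
  change (⟨x, - -v⟩ : TangentBundle 𝓘(ℝ, E) M) ∈ C ↔ _
  rw [neg_neg]

theorem domain_reversed (C : Set (TangentBundle 𝓘(ℝ, E) M)) :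
    domain (reversed C) = domain C := by
  ext x
  constructor
  · rintro ⟨v, hv⟩
    exact ⟨-v, hv⟩
  · rintro ⟨v, hv⟩
    refine ⟨-v, ?_⟩
    rw [mem_fiber_reversed, neg_neg]
    exact hv

/-- A cone field read in the chart at `p`. -/
def chartCone (C : Set (TangentBundle 𝓘(ℝ, E) M)) (p : M) : Set (E × E) :=
  {q | q.1 ∈ (chartAt E p).target ∧
    tangentMap 𝓘(ℝ, E) 𝓘(ℝ, E) (chartAt E p).symm (⟨q.1, q.2⟩ : TangentBundle 𝓘(ℝ, E) E) ∈ C}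

theorem mem_chartCone {C : Set (TangentBundle 𝓘(ℝ, E) M)} {p : M} {y w : E} :
    (y, w) ∈ chartCone C p ↔ y ∈ (chartAt E p).target ∧
      mfderiv 𝓘(ℝ, E) 𝓘(ℝ, E) (chartAt E p).symm y w ∈ fiber C ((chartAt E p).symm y) := Iff.rfl

theorem mem_chartCone_reversed {C : Set (TangentBundle 𝓘(ℝ, E) M)} {p : M} {y w : E} :
    (y, w) ∈ chartCone (reversed C) p ↔ (y, -w) ∈ chartCone C p := by
  rw [mem_chartCone, mem_chartCone, mem_fiber_reversed]
  have : mfderiv 𝓘(ℝ, E) 𝓘(ℝ, E) (chartAt E p).symm y (-w) =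
      -mfderiv 𝓘(ℝ, E) 𝓘(ℝ, E) (chartAt E p).symm y w := map_neg _ _
  rw [this]

/-- A cone field that is closed in every chart up to the zero section. -/
structure IsChartClosed (C : Set (TangentBundle 𝓘(ℝ, E) M)) : Prop where
  zero_notMem : ∀ x, (0 : TangentSpace 𝓘(ℝ, E) x) ∉ fiber C x
  smul_mem : ∀ x, ∀ t : ℝ, 0 < t → ∀ v ∈ fiber C x, t • v ∈ fiber C x
  chart : ∀ p : M, IsClosedConeOn (chartCone C p) (chartAt E p).target

theorem IsChartClosed.reversed {C : Set (TangentBundle 𝓘(ℝ, E) M)} (hC : IsChartClosed C) :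
    IsChartClosed (reversed C) where
  zero_notMem x h := hC.zero_notMem x (by rwa [mem_fiber_reversed, neg_zero] at h)
  smul_mem x t ht v hv := by
    rw [mem_fiber_reversed, ← smul_neg]
    exact hC.smul_mem x t ht _ hv
  chart p := by
    have h := hC.chart p
    refine ⟨fun y => ?_, fun y w t ht hw => ?_, fun y => ?_, fun y hy w hw hcl => ?_⟩
    · simp only [mem_chartCone_reversed]
      exact (h.convex y).neg
    · rw [mem_chartCone_reversed] at hw ⊢
      rw [← smul_neg]
      exact h.smul_mem y _ t ht hw
    · obtain ⟨l, hl⟩ := h.halfSpace y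
      refine ⟨-l, fun w hw => ?_⟩
      simpa using hl _ (mem_chartCone_reversed.1 hw)
    · rw [mem_chartCone_reversed]
      refine h.closed y hy _ (neg_ne_zero.2 hw) ?_
      exact map_mem_closure (f := fun q : E × E => (q.1, -q.2)) (by fun_prop) hcl
        fun q hq => mem_chartCone_reversed.1 hq

/-- The curve `γ` has at time `t` a velocity in `C`. -/
def HasVelocity (C : Set (TangentBundle 𝓘(ℝ, E) M)) (γ : ℝ → M) (t : ℝ) : Prop :=
  MDifferentiableAt 𝓘(ℝ, ℝ) 𝓘(ℝ, E) γ t ∧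
    (mfderiv 𝓘(ℝ, ℝ) 𝓘(ℝ, E) γ t 1 : TangentSpace 𝓘(ℝ, E) (γ t)) ∈ fiber C (γ t)

theorem HasVelocity.mem_domain {C : Set (TangentBundle 𝓘(ℝ, E) M)} {γ : ℝ → M} {t : ℝ}
    (h : HasVelocity C γ t) : γ t ∈ domain C := ⟨_, h.2⟩

theorem HasVelocity.congr {C : Set (TangentBundle 𝓘(ℝ, E) M)} {γ η : ℝ → M} {t : ℝ}
    (h : HasVelocity C γ t) (heq : η =ᶠ[𝓝 t] γ) : HasVelocity C η t := by
  refine ⟨h.1.congr_of_eventuallyEq heq, ?_⟩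
  have h1 : γ t = η t := heq.eq_of_nhds.symm
  have h2 : (mfderiv 𝓘(ℝ, ℝ) 𝓘(ℝ, E) η t : ℝ →L[ℝ] E) = mfderiv 𝓘(ℝ, ℝ) 𝓘(ℝ, E) γ t :=
    heq.mfderiv_eq
  have h3 : ∀ x, γ t = x → (⟨x, (mfderiv 𝓘(ℝ, ℝ) 𝓘(ℝ, E) γ t : ℝ →L[ℝ] E) 1⟩ :
      TangentBundle 𝓘(ℝ, E) M) ∈ C := by
    rintro _ rfl
    exact h.2
  have h4 := h3 _ h1
  rw [← h2] at h4
  exact h4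

variable [IsManifold 𝓘(ℝ, E) ∞ M]

/-- The tangent map of the inverse chart is continuous over the target and linear on fibres, so
everything pulls back. Its injectivity prevents a nonzero limit vector from landing in the zero
section. -/
theorem IsClosedConeField.isChartClosed [FiniteDimensional ℝ E]
    {C : Set (TangentBundle 𝓘(ℝ, E) M)}
    (hC : IsClosedConeField C) : IsChartClosed C := by
  have hinf : IsManifold 𝓘(ℝ, E) 1 M := IsManifold.of_le (n := ∞) (by norm_num)
  have h0 : ∀ x, (0 : TangentSpace 𝓘(ℝ, E) x) ∉ fiber C x := fun x h => by
    obtain ⟨l, hl⟩ := (hC.cone x).halfSpace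
    simpa using hl 0 h
  refine ⟨h0, fun x => (hC.cone x).smul_mem, fun p => ?_⟩
  set e := chartAt E p with he
  have hmd := mdifferentiable_chart (I := 𝓘(ℝ, E)) p
  refine ⟨fun y => ?_, fun y w t ht hw => ?_, fun y => ?_, fun y hy w hw hcl => ?_⟩
  · by_cases hy : y ∈ e.target
    · have := (hC.cone (e.symm y)).convex.linear_preimage
        (mfderiv 𝓘(ℝ, E) 𝓘(ℝ, E) e.symm y).toLinearMap
      convert! this using 1
      ext w
      exact ⟨fun h => h.2, fun h => ⟨hy, h⟩⟩
    · convert! convex_empty (𝕜 := ℝ) (E := E)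
      ext w
      simp only [mem_ofPred_eq, mem_empty_iff_false, iff_false]
      exact fun h => hy h.1
  · refine ⟨hw.1, ?_⟩
    have h1 := (hC.cone (e.symm y)).smul_mem t ht _ hw.2
    have : mfderiv 𝓘(ℝ, E) 𝓘(ℝ, E) e.symm y (t • w) =
      t • mfderiv 𝓘(ℝ, E) 𝓘(ℝ, E) e.symm y w := map_smul _ _ _
    change mfderiv 𝓘(ℝ, E) 𝓘(ℝ, E) e.symm y (t • w) ∈ fiber C (e.symm y)
    rw [this]
    exact h1
  · obtain ⟨l, hl⟩ := (hC.cone (e.symm y)).halfSpace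
    refine ⟨LinearMap.toContinuousLinearMap
      (l.comp (mfderiv 𝓘(ℝ, E) 𝓘(ℝ, E) e.symm y).toLinearMap : E →ₗ[ℝ] ℝ), fun w hw => ?_⟩
    exact hl _ hw.2
  · have hcm : ContMDiffOn 𝓘(ℝ, E) 𝓘(ℝ, E) 1 e.symm e.target := contMDiffOn_chart_symm
    have hct := (hcm.continuousOn_tangentMapWithin le_rfl e.open_target.uniqueMDiffOn)
    have hct' : ContinuousOn (tangentMap 𝓘(ℝ, E) 𝓘(ℝ, E) e.symm)
        (Bundle.TotalSpace.proj ⁻¹' e.target) := by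
      refine hct.congr fun q hq => (tangentMapWithin_eq_tangentMap
        (e.open_target.uniqueMDiffOn _ hq) (hmd.mdifferentiableAt_symm hq)).symm
    let G : E × E → TangentBundle 𝓘(ℝ, E) M := fun q =>
      tangentMap 𝓘(ℝ, E) 𝓘(ℝ, E) e.symm (⟨q.1, q.2⟩ : TangentBundle 𝓘(ℝ, E) E)
    have hinv : Continuous fun q : E × E => (⟨q.1, q.2⟩ : TangentBundle 𝓘(ℝ, E) E) :=
      (tangentBundleModelSpaceHomeomorph 𝓘(ℝ, E)).symm.continuous
    have hG : ContinuousAt G (y, w) := by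
      refine ContinuousAt.comp (g := tangentMap 𝓘(ℝ, E) 𝓘(ℝ, E) e.symm) ?_ hinv.continuousAt
      refine hct'.continuousAt ?_
      exact (e.open_target.preimage (FiberBundle.continuous_proj E _)).mem_nhds hy
    have hmem : G (y, w) ∈ closure C :=
      closure_mono (image_subset_iff.2 fun q hq => hq.2) (mem_closure_image hG hcl)
    have hmem' : G (y, w) ∈ C ∪ {p | p.2 = 0} :=
      closure_minimal subset_union_left hC.closed hmem
    refine ⟨hy, hmem'.resolve_right fun h => hw ?_⟩
    have hinj : Function.Injective (mfderiv 𝓘(ℝ, E) 𝓘(ℝ, E) e.symm y) := hmd.symm.mfderiv_injective hy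
    exact hinj (h.trans (map_zero _).symm)

theorem hasVelocity_symm_comp_iff {C : Set (TangentBundle 𝓘(ℝ, E) M)} {c : ℝ → E} {t : ℝ} {p : M}
    (hc : DifferentiableAt ℝ c t) (ht : c t ∈ (chartAt E p).target) :
    HasVelocity C ((chartAt E p).symm ∘ c) t ↔ (c t, deriv c t) ∈ chartCone C p := by
  have hinf : IsManifold 𝓘(ℝ, E) 1 M := IsManifold.of_le (n := ∞) (by norm_num)
  have h1 := (mdifferentiable_chart (I := 𝓘(ℝ, E)) p).mdifferentiableAt_symm ht
  have h2 : MDifferentiableAt 𝓘(ℝ, ℝ) 𝓘(ℝ, E) c t := hc.mdifferentiableAt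
  have h3 := mfderiv_comp_apply t h1 h2 (1 : ℝ)
  have h4 : mfderiv 𝓘(ℝ, ℝ) 𝓘(ℝ, E) c t (1 : ℝ) = deriv c t := by
    rw [mfderiv_eq_fderiv]
    rfl
  rw [h4] at h3
  rw [mem_chartCone]
  exact ⟨fun h => ⟨ht, h3 ▸ h.2⟩, fun h => ⟨h1.comp t h2, h3 ▸ h.2⟩⟩

theorem hasVelocity_iff {C : Set (TangentBundle 𝓘(ℝ, E) M)} {γ : ℝ → M} {t : ℝ} {p : M}
    (hγ : ContinuousAt γ t) (ht : γ t ∈ (chartAt E p).source) :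
    HasVelocity C γ t ↔ DifferentiableAt ℝ (chartAt E p ∘ γ) t ∧
      (chartAt E p (γ t), deriv (chartAt E p ∘ γ) t) ∈ chartCone C p := by
  have hinf : IsManifold 𝓘(ℝ, E) 1 M := IsManifold.of_le (n := ∞) (by norm_num)
  have heq : (chartAt E p).symm ∘ (chartAt E p ∘ γ) =ᶠ[𝓝 t] γ := by
    filter_upwards [hγ ((chartAt E p).open_source.mem_nhds ht)] with s hs
    exact (chartAt E p).left_inv hs
  have ht' := (chartAt E p).map_source ht
  constructor
  · intro h
    have hd : DifferentiableAt ℝ (chartAt E p ∘ γ) t := by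
      rw [← mdifferentiableAt_iff_differentiableAt]
      exact ((mdifferentiable_chart (I := 𝓘(ℝ, E)) p).mdifferentiableAt ht).comp t h.1
    exact ⟨hd, (hasVelocity_symm_comp_iff hd ht').1 (h.congr heq)⟩
  · rintro ⟨hd, h⟩
    exact ((hasVelocity_symm_comp_iff hd ht').2 h).congr heq.symm

theorem exists_mem_chartCone_iff {C : Set (TangentBundle 𝓘(ℝ, E) M)} {x p : M}
    (hx : x ∈ (chartAt E p).source) :
    (∃ w, (chartAt E p x, w) ∈ chartCone C p) ↔ x ∈ domain C := by
  have hinf : IsManifold 𝓘(ℝ, E) 1 M := IsManifold.of_le (n := ∞) (by norm_num)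
  have hx' := (chartAt E p).map_source hx
  have hinv := (chartAt E p).left_inv hx
  have key : ∀ y, (chartAt E p).symm (chartAt E p x) = y →
      ((∃ w, (chartAt E p x, w) ∈ chartCone C p) ↔ y ∈ domain C) := by
    rintro _ rfl
    constructor
    · rintro ⟨w, hw⟩
      exact ⟨_, hw.2⟩
    · rintro ⟨v, hv⟩
      obtain ⟨w, hw⟩ := (mdifferentiable_chart (I := 𝓘(ℝ, E)) p).symm.mfderiv_surjective hx' v
      refine ⟨w, hx', ?_⟩
      change mfderiv 𝓘(ℝ, E) 𝓘(ℝ, E) (chartAt E p).symm (chartAt E p x) w ∈ fiber C _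
      rw [hw]
      exact hv
  exact key x hinv

theorem IsChartClosed.isClosed_domain [FiniteDimensional ℝ E] {C : Set (TangentBundle 𝓘(ℝ, E) M)}
    (hC : IsChartClosed C) : IsClosed (domain C) := by
  rw [← isOpen_compl_iff, isOpen_iff_mem_nhds]
  intro x hx
  have hxs := mem_chart_source E x
  -- The fibre at `x` is empty, so the zero form qualifies; the bound then forces nearby cone
  -- vectors to vanish, and there are none.
  obtain ⟨r, hr, K, hK, h⟩ := (hC.chart x).exists_ball_norm_le ((chartAt E x).map_source hxs) 0
    fun w hw => absurd ((exists_mem_chartCone_iff hxs).1 ⟨w, hw⟩) hx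
  have h1 := ((chartAt E x).continuousAt hxs) (Metric.ball_mem_nhds _ hr)
  filter_upwards [h1, (chartAt E x).open_source.mem_nhds hxs] with y hy hys hyd
  obtain ⟨w, hw⟩ := (exists_mem_chartCone_iff hys).2 hyd
  have h2 := h _ hw hy
  have h3 : w = 0 := by simpa using h2
  obtain ⟨l, hl⟩ := (hC.chart x).halfSpace (chartAt E x y)
  have := hl w hw
  simp [h3] at this

end Charts

end ConeField

/-! ### Lipschitz curves: change of chart, gluing, affine reparametrization. -/

namespace ConeField

section LipschitzAt

variable {E : Type*} [NormedAddCommGroup E]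
  {M : Type*} [TopologicalSpace M] [ChartedSpace E M]

variable (E) in
/-- `γ` is continuous at `t` within `I`, and Lipschitz near `t` in the chart at `p`. -/
def IsLipschitzNear (I : Set ℝ) (γ : ℝ → M) (p : M) (t : ℝ) : Prop :=
  ContinuousWithinAt γ I t ∧
    ∃ K : NNReal, ∃ u ∈ 𝓝[I] t, LipschitzOnWith K (fun s => chartAt E p (γ s)) u

theorem isLocallyLipschitzCurve_iff [NormedSpace ℝ E] {I : Set ℝ} {γ : ℝ → M} :
    IsLocallyLipschitzCurve E I γ ↔ ∀ t ∈ I, IsLipschitzNear E I γ (γ t) t :=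
  ⟨fun h t ht => ⟨h.1 t ht, h.2 t ht⟩, fun h => ⟨fun t ht => (h t ht).1, fun t ht => (h t ht).2⟩⟩

theorem IsLipschitzNear.mono {I J : Set ℝ} {γ : ℝ → M} {p : M} {t : ℝ}
    (h : IsLipschitzNear E I γ p t) (hJ : 𝓝[J] t ≤ 𝓝[I] t) : IsLipschitzNear E J γ p t := by
  obtain ⟨h1, K, u, hu, h2⟩ := h
  exact ⟨h1.mono_left hJ, K, u, hJ hu, h2⟩

theorem IsLipschitzNear.congr {I : Set ℝ} {γ η : ℝ → M} {p : M} {t : ℝ}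
    (h : IsLipschitzNear E I γ p t) (heq : EqOn η γ I) (ht : t ∈ I) :
    IsLipschitzNear E I η p t := by
  obtain ⟨h1, K, u, hu, h2⟩ := h
  refine ⟨h1.congr heq (heq ht), K, u ∩ I, inter_mem hu self_mem_nhdsWithin, ?_⟩
  intro s hs s' hs'
  simp only [heq hs.2, heq hs'.2]
  exact h2 hs.1 hs'.1

theorem IsLipschitzNear.change [NormedSpace ℝ E] [IsManifold 𝓘(ℝ, E) ∞ M] {I : Set ℝ} {γ : ℝ → M} {p q : M} {t : ℝ}
    (h : IsLipschitzNear E I γ p t) (hp : γ t ∈ (chartAt E p).source)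
    (hq : γ t ∈ (chartAt E q).source) : IsLipschitzNear E I γ q t := by
  have hinf : IsManifold 𝓘(ℝ, E) 1 M := IsManifold.of_le (n := ∞) (by norm_num)
  obtain ⟨h1, K, u, hu, h2⟩ := h
  have hcd : ContDiffAt ℝ 1 (chartAt E q ∘ (chartAt E p).symm) (chartAt E p (γ t)) := by
    have := contDiffWithinAt_ext_coord_change (I := 𝓘(ℝ, E)) (n := 1) q p
      (y := chartAt E p (γ t)) (by
        simp only [mfld_simps]
        exact ⟨(chartAt E p).map_source hp, by simpa [(chartAt E p).left_inv hp] using hq⟩)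
    simpa [contDiffWithinAt_univ] using this
  obtain ⟨K', v, hv, hL⟩ := hcd.exists_lipschitzOnWith
  have hcont : ContinuousWithinAt (fun s => chartAt E p (γ s)) I t :=
    ((chartAt E p).continuousAt hp).comp_continuousWithinAt h1
  refine ⟨h1, K' * K, u ∩ ((fun s => chartAt E p (γ s)) ⁻¹' v ∩ γ ⁻¹' (chartAt E p).source),
    inter_mem hu (inter_mem (hcont hv) (h1 ((chartAt E p).open_source.mem_nhds hp))), ?_⟩
  have := hL.comp (h2.mono (inter_subset_left (t := (fun s => chartAt E p (γ s)) ⁻¹' v ∩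
    γ ⁻¹' (chartAt E p).source))) fun s hs => hs.2.1
  intro s hs s' hs'
  have h3 := this hs hs'
  simp only [Function.comp_apply, (chartAt E p).left_inv hs.2.2,
    (chartAt E p).left_inv hs'.2.2] at h3
  exact h3

theorem IsLipschitzNear.union {I J : Set ℝ} {γ : ℝ → M} {p : M} {b : ℝ}
    (hI : IsLipschitzNear E I γ p b) (hJ : IsLipschitzNear E J γ p b) (hIb : IsGreatest I b)
    (hJb : IsLeast J b) : IsLipschitzNear E (I ∪ J) γ p b := by
  obtain ⟨h1, K, u, hu, hK⟩ := hI
  obtain ⟨h1', K', u', hu', hK'⟩ := hJ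
  have hbu : b ∈ u := mem_of_mem_nhdsWithin hIb.1 hu
  have hbu' : b ∈ u' := mem_of_mem_nhdsWithin hJb.1 hu'
  refine ⟨h1.union h1', max K K', (u ∩ I) ∪ (u' ∩ J), ?_, ?_⟩
  · rw [nhdsWithin_union]
    exact mem_sup.2 ⟨mem_of_superset (inter_mem hu self_mem_nhdsWithin) subset_union_left,
      mem_of_superset (inter_mem hu' self_mem_nhdsWithin) subset_union_right⟩
  · have hm : ∀ s ∈ u ∩ I, ∀ t ∈ u' ∩ J, dist (chartAt E p (γ s)) (chartAt E p (γ t)) ≤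
        (max K K' : NNReal) * dist s t := by
      intro s hs t ht
      have hsb := hIb.2 hs.2
      have hbt := hJb.2 ht.2
      have e1 := hK.dist_le_mul s hs.1 b hbu
      have e2 := hK'.dist_le_mul b hbu' t ht.1
      have e3 := dist_triangle (chartAt E p (γ s)) (chartAt E p (γ b)) (chartAt E p (γ t))
      rw [Real.dist_eq, abs_of_nonpos (by linarith)] at e1 e2 ⊢
      have e4 : (K : ℝ) ≤ (max K K' : NNReal) := by exact_mod_cast le_max_left _ _
      have e5 : (K' : ℝ) ≤ (max K K' : NNReal) := by exact_mod_cast le_max_right _ _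
      nlinarith [mul_le_mul_of_nonneg_right e4 (sub_nonneg.2 hsb),
        mul_le_mul_of_nonneg_right e5 (sub_nonneg.2 hbt)]
    refine LipschitzOnWith.of_dist_le_mul ?_
    rintro s (hs | hs) t (ht | ht)
    · exact ((hK.weaken (le_max_left K K')).dist_le_mul s hs.1 t ht.1)
    · exact hm s hs t ht
    · rw [dist_comm, dist_comm s]
      exact hm t ht s hs
    · exact ((hK'.weaken (le_max_right K K')).dist_le_mul s hs.1 t ht.1)

theorem IsLipschitzNear.comp_affine {I : Set ℝ} {γ : ℝ → M} {p : M} {α β t : ℝ}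
    (h : IsLipschitzNear E I γ p (α * t + β)) :
    IsLipschitzNear E ((fun s => α * s + β) ⁻¹' I) (fun s => γ (α * s + β)) p t := by
  obtain ⟨h1, K, u, hu, h2⟩ := h
  have hφ : ContinuousWithinAt (fun s => α * s + β) ((fun s => α * s + β) ⁻¹' I) t :=
    Continuous.continuousWithinAt (by fun_prop)
  have hφ' := hφ.tendsto_nhdsWithin (mapsTo_preimage _ I)
  refine ⟨Tendsto.comp h1 hφ', K * ‖α‖₊, (fun s => α * s + β) ⁻¹' u, hφ' hu, ?_⟩
  have hL : LipschitzWith ‖α‖₊ (fun s : ℝ => α * s + β) := by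
    refine LipschitzWith.of_dist_le_mul fun x y => ?_
    rw [Real.dist_eq, Real.dist_eq, coe_nnnorm, Real.norm_eq_abs, ← abs_mul]
    apply le_of_eq
    congr 1
    ring
  exact h2.comp (hL.lipschitzOnWith) (mapsTo_preimage _ _)

end LipschitzAt

/-! ### Causal curves: gluing, reparametrization, restriction. -/

section Curves

variable {E : Type*} [NormedAddCommGroup E] [NormedSpace ℝ E]
  {M : Type*} [TopologicalSpace M] [ChartedSpace E M]
  {C : Set (TangentBundle 𝓘(ℝ, E) M)} {I J : Set ℝ} {γ η : ℝ → M}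

theorem ae_mem_interior_of_ordConnected (hI : I.OrdConnected) :
    ∀ᵐ t : ℝ, t ∈ I → t ∈ interior I := by
  have : volume (frontier I) = 0 := hI.convex.addHaar_frontier volume
  filter_upwards [measure_eq_zero_iff_ae_notMem.1 this] with t ht htI
  by_contra h
  exact ht ⟨subset_closure htI, h⟩

/-- The frontier of an interval is null, and at interior times the derivative within `I` is the
ordinary one. All later velocity arguments use this two-sided form. -/
theorem ae_velocity_iff (hI : I.OrdConnected) :
    (∀ᵐ t ∂(volume.restrict I), MDifferentiableWithinAt 𝓘(ℝ, ℝ) 𝓘(ℝ, E) γ I t ∧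
      (mfderivWithin 𝓘(ℝ, ℝ) 𝓘(ℝ, E) γ I t 1 : TangentSpace 𝓘(ℝ, E) (γ t)) ∈ fiber C (γ t)) ↔
    ∀ᵐ t, t ∈ interior I → HasVelocity C γ t := by
  rw [ae_restrict_iff' hI.measurableSet]
  have key : ∀ t ∈ interior I, (MDifferentiableWithinAt 𝓘(ℝ, ℝ) 𝓘(ℝ, E) γ I t ∧
      (mfderivWithin 𝓘(ℝ, ℝ) 𝓘(ℝ, E) γ I t 1 : TangentSpace 𝓘(ℝ, E) (γ t)) ∈ fiber C (γ t)) ↔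
      HasVelocity C γ t := by
    intro t ht
    have hn : I ∈ 𝓝 t := mem_interior_iff_mem_nhds.1 ht
    rw [HasVelocity, mfderivWithin_of_mem_nhds hn]
    refine and_congr_left fun _ => ⟨fun h => h.mdifferentiableAt hn, fun h =>
      h.mdifferentiableWithinAt⟩
  constructor
  · intro h
    filter_upwards [h] with t ht hti
    exact (key t hti).1 (ht (interior_subset hti))
  · intro h
    filter_upwards [h, ae_mem_interior_of_ordConnected hI] with t ht hti htI
    exact (key t (hti htI)).2 (ht (hti htI))

theorem IsCausalCurve.ae_hasVelocity (h : IsCausalCurve C I γ) :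
    ∀ᵐ t, t ∈ interior I → HasVelocity C γ t := (ae_velocity_iff h.ordConnected).1 h.velocity

theorem IsCausalCurve.isLipschitzNear (h : IsCausalCurve C I γ) {t : ℝ} (ht : t ∈ I) :
    IsLipschitzNear E I γ (γ t) t := isLocallyLipschitzCurve_iff.1 h.locallyLipschitz t ht

theorem IsCausalCurve.continuousOn (h : IsCausalCurve C I γ) : ContinuousOn γ I :=
  h.locallyLipschitz.1

theorem IsCausalCurve.of_near (hne : I.Nonempty) (hI : I.OrdConnected)
    (hL : ∀ t ∈ I, IsLipschitzNear E I γ (γ t) t)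
    (hv : ∀ᵐ t, t ∈ interior I → HasVelocity C γ t)
    (ht : I.Subsingleton → ∀ t ∈ I, γ t ∈ domain C) : IsCausalCurve C I γ :=
  ⟨hne, hI, isLocallyLipschitzCurve_iff.2 hL, (ae_velocity_iff hI).2 hv, ht⟩

theorem isCausalCurve_singleton {x : M} (hx : x ∈ domain C) (t₀ : ℝ) :
    IsCausalCurve C {t₀} (fun _ => x) := by
  refine .of_near (singleton_nonempty _) ordConnected_singleton (fun t _ => ⟨?_, 0, univ,
    univ_mem, LipschitzOnWith.of_dist_le_mul (by simp)⟩) ?_ fun _ _ _ => hx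
  · exact continuousWithinAt_const
  · simp

theorem IsCausalCurve.congr (h : IsCausalCurve C I γ) (heq : EqOn η γ I) :
    IsCausalCurve C I η := by
  refine .of_near h.nonempty h.ordConnected (fun t ht => ?_) ?_ fun hs t ht => ?_
  · rw [heq ht]
    exact (h.isLipschitzNear ht).congr heq ht
  · filter_upwards [h.ae_hasVelocity] with t ht hti
    exact (ht hti).congr (heq.eventuallyEq_of_mem (mem_interior_iff_mem_nhds.1 hti))
  · rw [heq ht]
    exact h.trivial hs t ht

theorem IsCausalCurve.union (hI : IsCausalCurve C I γ) (hJ : IsCausalCurve C J γ) {b : ℝ}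
    (hIb : IsGreatest I b) (hJb : IsLeast J b) : IsCausalCurve C (I ∪ J) γ := by
  have hlt : ∀ t < b, (I ∪ J) ∩ Iio b ⊆ I := by
    rintro t - s ⟨hs | hs, hsb⟩
    · exact hs
    · exact absurd (hJb.2 hs) (not_le.2 hsb)
  have hgt : ∀ t > b, (I ∪ J) ∩ Ioi b ⊆ J := by
    rintro t - s ⟨hs | hs, hsb⟩
    · exact absurd (hIb.2 hs) (not_le.2 hsb)
    · exact hs
  have hnl : ∀ t < b, 𝓝[I ∪ J] t ≤ 𝓝[I] t := fun t ht => by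
    rw [← nhdsWithin_inter_of_mem' (mem_nhdsWithin_of_mem_nhds (Iio_mem_nhds ht))]
    exact nhdsWithin_mono _ (hlt t ht)
  have hnr : ∀ t > b, 𝓝[I ∪ J] t ≤ 𝓝[J] t := fun t ht => by
    rw [← nhdsWithin_inter_of_mem' (mem_nhdsWithin_of_mem_nhds (Ioi_mem_nhds ht))]
    exact nhdsWithin_mono _ (hgt t ht)
  refine .of_near (hI.nonempty.inl) ?_ (fun t ht => ?_) ?_ fun hs t ht => ?_
  · refine ⟨fun s hs t ht u hu => ?_⟩
    rcases le_total u b with hub | hub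
    · rcases hs with hs | hs
      · exact Or.inl (hI.ordConnected.out hs hIb.1 ⟨hu.1, hub⟩)
      · have : u = b := le_antisymm hub ((hJb.2 hs).trans hu.1)
        exact this ▸ Or.inl hIb.1
    · rcases ht with ht | ht
      · have : u = b := le_antisymm (hu.2.trans (hIb.2 ht)) hub
        exact this ▸ Or.inl hIb.1
      · exact Or.inr (hJ.ordConnected.out hJb.1 ht ⟨hub, hu.2⟩)
  · rcases lt_trichotomy t b with htb | rfl | htb
    · exact (hI.isLipschitzNear (hlt t htb ⟨ht, htb⟩)).mono (hnl t htb)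
    · exact (hI.isLipschitzNear hIb.1).union (hJ.isLipschitzNear hJb.1) hIb hJb
    · exact (hJ.isLipschitzNear (hgt t htb ⟨ht, htb⟩)).mono (hnr t htb)
  · have hb : ∀ᵐ t : ℝ, t ≠ b := Measure.ae_ne volume b
    filter_upwards [hI.ae_hasVelocity, hJ.ae_hasVelocity, hb] with t h1 h2 h3 ht
    have hn := mem_interior_iff_mem_nhds.1 ht
    rcases lt_or_gt_of_ne h3 with htb | htb
    · exact h1 (mem_interior_iff_mem_nhds.2
        (mem_of_superset (inter_mem hn (Iio_mem_nhds htb)) (hlt t htb)))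
    · exact h2 (mem_interior_iff_mem_nhds.2
        (mem_of_superset (inter_mem hn (Ioi_mem_nhds htb)) (hgt t htb)))
  · rcases ht with ht | ht
    · exact hI.trivial (hs.anti subset_union_left) t ht
    · exact hJ.trivial (hs.anti subset_union_right) t ht

theorem isCausalCurve_Ici {a : ℝ} (h : ∀ k : ℕ, IsCausalCurve C (Icc a (a + (k + 1))) γ) :
    IsCausalCurve C (Ici a) γ := by
  refine .of_near nonempty_Ici ordConnected_Ici (fun t ht => ?_) ?_ fun hs => ?_
  · obtain ⟨k, hk⟩ := exists_nat_gt (t - a)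
    have htk : t < a + (k + 1) := by linarith
    refine ((h k).isLipschitzNear ⟨ht, htk.le⟩).mono ?_
    rw [← nhdsWithin_inter_of_mem' (mem_nhdsWithin_of_mem_nhds (Iio_mem_nhds htk))]
    exact nhdsWithin_mono _ fun s hs => ⟨hs.1, hs.2.le⟩
  · filter_upwards [ae_all_iff.2 fun k => (h k).ae_hasVelocity] with t ht hti
    obtain ⟨k, hk⟩ := exists_nat_gt (t - a)
    rw [interior_Ici] at hti
    refine ht k ?_
    rw [interior_Icc]
    exact ⟨hti, by linarith⟩
  · exact absurd (hs (x := a) self_mem_Ici (y := a + 1) (by simp)) (by simp)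

end Curves

section Manifold

variable {E : Type*} [NormedAddCommGroup E] [NormedSpace ℝ E]
  {M : Type*} [TopologicalSpace M] [ChartedSpace E M]
  {C C' : Set (TangentBundle 𝓘(ℝ, E) M)} {I J : Set ℝ} {γ η : ℝ → M}

theorem ae_affine {P : ℝ → Prop} {α : ℝ} (hα : α ≠ 0) (β : ℝ) (h : ∀ᵐ t, P t) :
    ∀ᵐ t, P (α * t + β) := by
  have h1 : ∀ᵐ t, P (t + β) :=
    (measurePreserving_add_right volume β).quasiMeasurePreserving.ae h
  have h2 : Measure.QuasiMeasurePreserving (fun t : ℝ => α * t) volume volume := by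
    refine ⟨by fun_prop, ?_⟩
    rw [Real.map_volume_mul_left hα]
    exact Measure.smul_absolutelyContinuous
  exact h2.ae h1

theorem HasVelocity.comp_affine {α β t : ℝ} (h : HasVelocity C γ (α * t + β))
    (hCC' : ∀ x, ∀ v ∈ fiber C x, α • v ∈ fiber C' x) :
    HasVelocity C' (fun s => γ (α * s + β)) t := by
  have hφ : HasDerivAt (fun s => α * s + β) α t := by
    simpa using ((hasDerivAt_id t).const_mul α).add_const β
  have h2 : MDifferentiableAt 𝓘(ℝ, ℝ) 𝓘(ℝ, ℝ) (fun s => α * s + β) t :=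
    hφ.differentiableAt.mdifferentiableAt
  refine ⟨h.1.comp t h2, ?_⟩
  have h3 := mfderiv_comp_apply t h.1 h2 (1 : ℝ)
  have h4 : mfderiv 𝓘(ℝ, ℝ) 𝓘(ℝ, ℝ) (fun s => α * s + β) t (1 : ℝ) = α := by
    rw [mfderiv_eq_fderiv]
    exact hφ.deriv
  rw [h4] at h3
  have h5 : mfderiv 𝓘(ℝ, ℝ) 𝓘(ℝ, E) γ (α * t + β) α =
      α • mfderiv 𝓘(ℝ, ℝ) 𝓘(ℝ, E) γ (α * t + β) (1 : ℝ) := by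
    have := (mfderiv 𝓘(ℝ, ℝ) 𝓘(ℝ, E) γ (α * t + β)).map_smul α (1 : ℝ)
    rw [← this]
    congr 1
    exact (mul_one α).symm
  have h6 := hCC' _ _ h.2
  have h7 : ∀ w : E, w = α • (mfderiv 𝓘(ℝ, ℝ) 𝓘(ℝ, E) γ (α * t + β) : ℝ →L[ℝ] E) 1 →
      w ∈ (fiber C' (γ (α * t + β)) : Set E) := by
    rintro _ rfl
    exact h6
  exact h7 _ (h3.trans h5)

/-- Two cone fields appear so that translations, positive rescalings and time reversal (with
`reversed C` and `α = -1`) are one statement. -/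
theorem IsCausalCurve.comp_affine {α β : ℝ} (hα : α ≠ 0) (h : IsCausalCurve C I γ)
    (hCC' : ∀ x, ∀ v ∈ fiber C x, α • v ∈ fiber C' x) :
    IsCausalCurve C' ((fun s => α * s + β) ⁻¹' I) (fun s => γ (α * s + β)) := by
  have hinv : ∀ u, α * ((u - β) / α) + β = u := fun u => by field_simp; ring
  have hsurj : Function.Surjective (fun s => α * s + β) := fun u => ⟨(u - β) / α, hinv u⟩
  have hdom : domain C ⊆ domain C' := fun x ⟨v, hv⟩ => ⟨_, hCC' x v hv⟩
  refine .of_near (h.nonempty.preimage hsurj) ?_ (fun t ht => ?_) ?_ fun hs t ht => ?_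
  · rcases lt_or_gt_of_ne hα with hα | hα
    · exact h.ordConnected.preimage_anti fun s t hst => by
        nlinarith
    · exact h.ordConnected.preimage_mono fun s t hst => by
        nlinarith
  · exact (h.isLipschitzNear ht).comp_affine
  · filter_upwards [ae_affine hα β h.ae_hasVelocity] with t ht hti
    refine (ht ?_).comp_affine hCC'
    let φ : ℝ ≃ₜ ℝ := (Homeomorph.mulLeft₀ α hα).trans (Homeomorph.addRight β)
    have : φ ⁻¹' interior I = interior (φ ⁻¹' I) := φ.preimage_interior I
    change t ∈ φ ⁻¹' interior I
    rw [this]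
    exact hti
  · refine hdom (h.trivial ?_ _ ht)
    intro a ha b hb
    have := hs (x := (a - β) / α) (by simpa [hinv] using ha) (y := (b - β) / α)
      (by simpa [hinv] using hb)
    rw [← hinv a, ← hinv b, this]

theorem IsCausalCurve.comp_neg (h : IsCausalCurve C I γ) :
    IsCausalCurve (reversed C) (-I) (fun s => γ (-s)) := by
  have := h.comp_affine (C' := reversed C) (α := -1) (β := 0) (by norm_num) fun x v hv => by
    rw [mem_fiber_reversed, neg_smul, one_smul, neg_neg]
    exact hv
  simpa [Set.neg] using this

theorem IsCausalCurve.comp_add (h : IsCausalCurve C I γ) (β : ℝ) :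
    IsCausalCurve C ((fun s => s + β) ⁻¹' I) (fun s => γ (s + β)) := by
  have := h.comp_affine (C' := C) (α := 1) (β := β) (by norm_num) fun x v hv => by
    rwa [one_smul]
  simpa using this

variable [IsManifold 𝓘(ℝ, E) ∞ M]

/-- Almost every time has a velocity in the cone, so times in the domain are dense in a
nondegenerate interval; the domain is closed. -/
theorem IsCausalCurve.mem_domain [FiniteDimensional ℝ E] (hC : IsChartClosed C)
    (h : IsCausalCurve C I γ) {t : ℝ} (ht : t ∈ I) : γ t ∈ domain C := by
  by_cases hs : I.Subsingleton
  · exact h.trivial hs t ht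
  have hint : (interior I).Nonempty := by
    rw [not_subsingleton_iff] at hs
    exact h.ordConnected.convex.nontrivial_iff_nonempty_interior.1 hs
  by_contra hD
  have h1 := h.continuousOn t ht (hC.isClosed_domain.isOpen_compl.mem_nhds hD)
  obtain ⟨V, hV, htV, hVI⟩ := mem_nhdsWithin.1 h1
  have hcl : t ∈ closure (interior I) :=
    ((Convex.closure_interior_eq_closure_of_nonempty_interior (𝕜 := ℝ)
      h.ordConnected.convex hint).symm ▸ subset_closure ht :)
  have hne : (V ∩ interior I).Nonempty := mem_closure_iff.1 hcl V hV htV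
  have hpos : volume (V ∩ interior I) ≠ 0 := (hV.inter isOpen_interior).measure_ne_zero _ hne
  apply hpos
  rw [measure_eq_zero_iff_ae_notMem]
  filter_upwards [h.ae_hasVelocity] with s hs hsV
  exact hVI ⟨hsV.1, interior_subset hsV.2⟩ (hs hsV.2).mem_domain

theorem IsCausalCurve.restrict [FiniteDimensional ℝ E] (hC : IsChartClosed C)
    (h : IsCausalCurve C I γ) (hJI : J ⊆ I) (hJ : J.OrdConnected) (hne : J.Nonempty) :
    IsCausalCurve C J γ := by
  refine .of_near hne hJ (fun t ht => (h.isLipschitzNear (hJI ht)).mono (nhdsWithin_mono _ hJI))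
    ?_ fun _ t ht => h.mem_domain hC (hJI ht)
  filter_upwards [h.ae_hasVelocity] with t ht hti
  exact ht (interior_mono hJI hti)

end Manifold

end ConeField

/-! ### Boxes: causal curves as graphs over a linear form. -/

namespace ConeField

section Boxes

variable {E : Type*} [NormedAddCommGroup E] [NormedSpace ℝ E]
  {M : Type*} [TopologicalSpace M] [ChartedSpace E M]
  {C : Set (TangentBundle 𝓘(ℝ, E) M)} {I J : Set ℝ} {γ η : ℝ → M}

/-- A ball of a chart on which a linear form controls the norm of the vectors of the cone field. -/
structure ChartBox (C : Set (TangentBundle 𝓘(ℝ, E) M)) where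
  center : M
  form : E →L[ℝ] ℝ
  radius : ℝ
  radius_pos : 0 < radius
  closedBall_subset : Metric.closedBall (chartAt E center center) (2 * radius) ⊆
    (chartAt E center).target
  norm_le : ∀ q ∈ chartCone C center,
    q.1 ∈ Metric.closedBall (chartAt E center center) (2 * radius) → ‖q.2‖ ≤ form q.2

namespace ChartBox

variable (B : ChartBox C)

/-- The points of the open ball of radius `radius`. -/
def small : Set M :=
  (chartAt E B.center).source ∩
    chartAt E B.center ⁻¹' Metric.ball (chartAt E B.center B.center) B.radius

/-- The points of the closed ball of radius `2 * radius`. -/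
def big : Set M :=
  (chartAt E B.center).source ∩
    chartAt E B.center ⁻¹' Metric.closedBall (chartAt E B.center B.center) (2 * B.radius)

/-- The form of the box as a function on the manifold. -/
def height (x : M) : ℝ := B.form (chartAt E B.center x)

theorem isOpen_small : IsOpen B.small :=
  (chartAt E B.center).isOpen_inter_preimage Metric.isOpen_ball

theorem small_subset_big : B.small ⊆ B.big := fun _ hx =>
  ⟨hx.1, Metric.ball_subset_closedBall (Metric.ball_subset_ball (by linarith [B.radius_pos]) hx.2)⟩

theorem isCompact_big [FiniteDimensional ℝ E] : IsCompact B.big := by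
  have : ProperSpace E := FiniteDimensional.proper_real E
  have h := (isCompact_closedBall (chartAt E B.center B.center) (2 * B.radius)).image_of_continuousOn
    ((chartAt E B.center).continuousOn_symm.mono B.closedBall_subset)
  convert! h using 1
  rw [big, (chartAt E B.center).symm_image_eq_source_inter_preimage B.closedBall_subset]

theorem continuousOn_height : ContinuousOn B.height (chartAt E B.center).source :=
  B.form.continuous.comp_continuousOn (chartAt E B.center).continuousOn

theorem continuousOn_height_comp (h : IsCausalCurve C I γ) {a b : ℝ} (hI : Icc a b ⊆ I)
    (hB : ∀ u ∈ Icc a b, γ u ∈ B.big) : ContinuousOn (fun u => B.height (γ u)) (Icc a b) :=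
  B.continuousOn_height.comp (h.continuousOn.mono hI) fun u hu => (hB u hu).1

theorem tendsto_chart {ι : Type*} {l : Filter ι} {f : ι → M} {x : M} (hf : Tendsto f l (𝓝 x))
    (hx : x ∈ B.big) : Tendsto (fun i => chartAt E B.center (f i)) l (𝓝 (chartAt E B.center x)) :=
  ((chartAt E B.center).continuousAt hx.1).tendsto.comp hf

theorem tendsto_height {ι : Type*} {l : Filter ι} {f : ι → M} {x : M} (hf : Tendsto f l (𝓝 x))
    (hx : x ∈ B.big) : Tendsto (fun i => B.height (f i)) l (𝓝 (B.height x)) :=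
  (B.form.continuous.tendsto _).comp (B.tendsto_chart hf hx)

theorem exists_small [FiniteDimensional ℝ E] (hC : IsChartClosed C) (x : M) :
    ∃ B : ChartBox C, x ∈ B.small := by
  have hxs := mem_chart_source E x
  have hxt := (chartAt E x).map_source hxs
  obtain ⟨l, hl⟩ := (hC.chart x).halfSpace (chartAt E x x)
  obtain ⟨r, hr, K, hK, h⟩ := (hC.chart x).exists_ball_norm_le hxt l hl
  obtain ⟨ε, hε, hball⟩ := Metric.isOpen_iff.1 (chartAt E x).open_target _ hxt
  have hm : 0 < min r ε := lt_min hr hε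
  have hsub : Metric.closedBall (chartAt E x x) (2 * (min r ε / 4)) ⊆
      Metric.ball (chartAt E x x) (min r ε) := Metric.closedBall_subset_ball (by linarith)
  -- With a quarter of `min r ε`, the closed ball of twice the radius fits in the open ball where
  -- both the norm bound and the chart are available. The factor `K` is absorbed in the form.
  refine ⟨⟨x, K • l, min r ε / 4, by positivity,
    (hsub.trans (Metric.ball_subset_ball (min_le_right _ _))).trans hball, fun q hq hqb => ?_⟩,
    hxs, Metric.mem_ball_self (by positivity)⟩
  exact h q hq (Metric.ball_subset_ball (min_le_left _ _) (hsub hqb))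

end ChartBox

variable [IsManifold 𝓘(ℝ, E) ∞ M]

theorem IsCausalCurve.form_le (h : IsCausalCurve C I γ) {p : M} (n : E →L[ℝ] ℝ) {s t : ℝ}
    (hst : s ≤ t) (hI : Icc s t ⊆ I) (hp : ∀ u ∈ Icc s t, γ u ∈ (chartAt E p).source)
    (hn : ∀ u ∈ Icc s t, ∀ w, (chartAt E p (γ u), w) ∈ chartCone C p → 0 ≤ n w) :
    n (chartAt E p (γ s)) ≤ n (chartAt E p (γ t)) := by
  refine le_of_ae_deriv_nonneg (g := fun u => n (chartAt E p (γ u))) hst (fun u hu => ?_) ?_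
  · obtain ⟨-, K, v, hv, hK⟩ := (h.isLipschitzNear (hI hu)).change (mem_chart_source E _) (hp u hu)
    exact ⟨_, v, nhdsWithin_mono _ hI hv, n.lipschitz.comp_lipschitzOnWith hK⟩
  · filter_upwards [h.ae_hasVelocity] with u hu hui
    have hnb : I ∈ 𝓝 u := mem_of_superset (Icc_mem_nhds hui.1 hui.2) hI
    have hu' := Ioo_subset_Icc_self hui
    obtain ⟨hd, hm⟩ := (hasVelocity_iff ((h.continuousOn u (hI hu')).continuousAt hnb)
      (hp u hu')).1 (hu (mem_interior_iff_mem_nhds.2 hnb))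
    have : HasDerivAt (fun u => n (chartAt E p (γ u))) (n (deriv (chartAt E p ∘ γ) u)) u :=
      n.hasFDerivAt.comp_hasDerivAt u hd.hasDerivAt
    rw [this.deriv]
    exact hn u hu' _ hm

namespace ChartBox

variable (B : ChartBox C)

/-- Let `φ` be a norming functional of the displacement. Then `B.form - φ` is nonnegative on the
cones of the box, hence nondecreasing along the curve. -/
theorem norm_sub_le (h : IsCausalCurve C I γ) {s t : ℝ} (hst : s ≤ t) (hI : Icc s t ⊆ I)
    (hB : ∀ u ∈ Icc s t, γ u ∈ B.big) :
    ‖chartAt E B.center (γ t) - chartAt E B.center (γ s)‖ ≤ B.height (γ t) - B.height (γ s) := by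
  obtain ⟨φ, hφ, hφv⟩ := exists_dual_vector'' ℝ
    (chartAt E B.center (γ t) - chartAt E B.center (γ s))
  have := h.form_le (p := B.center) (B.form - φ) hst hI (fun u hu => (hB u hu).1)
    fun u hu w hw => by
      have h1 := B.norm_le _ hw (hB u hu).2
      have h2 := (le_abs_self _).trans (φ.le_of_opNorm_le hφ w)
      rw [sub_apply]
      simp only at h1
      linarith
  simp only [sub_apply, map_sub, RCLike.ofReal_real_eq_id, id] at this hφv
  rw [← hφv]
  simp only [height]
  linarith

theorem height_mono (h : IsCausalCurve C I γ) {s t : ℝ} (hst : s ≤ t) (hI : Icc s t ⊆ I)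
    (hB : ∀ u ∈ Icc s t, γ u ∈ B.big) : B.height (γ s) ≤ B.height (γ t) := by
  linarith [B.norm_sub_le h hst hI hB, norm_nonneg (chartAt E B.center (γ t) -
    chartAt E B.center (γ s))]

/-- A causal curve inside a box is a graph over the form of the box. -/
theorem exists_isConeGraph {a b : ℝ} (hab : a ≤ b) (h : IsCausalCurve C (Icc a b) γ)
    (hB : ∀ u ∈ Icc a b, γ u ∈ B.big) :
    ∃ c : ℝ → E, IsConeGraph (chartCone C B.center) B.form (B.height (γ b) - B.height (γ a)) c ∧
      c 0 = chartAt E B.center (γ a) ∧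
      c (B.height (γ b) - B.height (γ a)) = chartAt E B.center (γ b) := by
  set f : ℝ → ℝ := fun u => B.height (γ u) with hf
  set e := chartAt E B.center
  have hcont : ContinuousOn f (Icc a b) := B.continuousOn_height_comp h Subset.rfl hB
  have hsub : ∀ {s t}, s ∈ Icc a b → t ∈ Icc a b → Icc s t ⊆ Icc a b := fun hs ht =>
    Icc_subset_Icc hs.1 ht.2
  have hnorm : ∀ {s t}, s ∈ Icc a b → t ∈ Icc a b → s ≤ t → ‖e (γ t) - e (γ s)‖ ≤ f t - f s :=
    fun hs ht hst => B.norm_sub_le h hst (hsub hs ht) fun u hu => hB u (hsub hs ht hu)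
  have habs : ∀ {s t}, s ∈ Icc a b → t ∈ Icc a b → ‖e (γ s) - e (γ t)‖ ≤ |f s - f t| := by
    intro s t hs ht
    rcases le_total s t with hst | hst
    · rw [norm_sub_rev, abs_sub_comm]
      exact (hnorm hs ht hst).trans (le_abs_self _)
    · exact (hnorm ht hs hst).trans (le_abs_self _)
  have ha : a ∈ Icc a b := ⟨le_rfl, hab⟩
  have hb : b ∈ Icc a b := ⟨hab, le_rfl⟩
  -- Reparametrization by height. The choice of a time at each height is immaterial: by `habs`,
  -- equal heights mean equal points.
  have hex : ∀ s, ∃ t, s ∈ Icc 0 (f b - f a) → t ∈ Icc a b ∧ f t = f a + s := by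
    intro s
    by_cases hs : s ∈ Icc 0 (f b - f a)
    · obtain ⟨t, ht, hts⟩ := intermediate_value_Icc hab hcont (show f a + s ∈ Icc (f a) (f b) from
        ⟨by linarith [hs.1], by linarith [hs.2]⟩)
      exact ⟨t, fun _ => ⟨ht, hts⟩⟩
    · exact ⟨0, fun h => absurd h hs⟩
  choose τ hτ using hex
  have hfab : 0 ≤ f b - f a := (norm_nonneg _).trans (hnorm ha hb hab)
  have hend : ∀ {s t}, s ∈ Icc 0 (f b - f a) → t ∈ Icc a b → f t = f a + s →
      e (γ (τ s)) = e (γ t) := by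
    intro s t hs ht hts
    have h1 := habs (hτ s hs).1 ht
    rw [(hτ s hs).2, hts, sub_self, abs_zero] at h1
    exact sub_eq_zero.1 (norm_le_zero_iff.1 h1)
  have h0 : e (γ (τ 0)) = e (γ a) := hend ⟨le_rfl, hfab⟩ ha (by ring)
  refine ⟨fun s => e (γ (τ s)), ⟨fun s hs => ?_, fun s hs t ht => ?_, ?_⟩, h0,
    hend ⟨hfab, le_rfl⟩ hb (by ring)⟩
  · simp only [h0]
    exact (hτ s hs).2
  · refine (habs (hτ s hs).1 (hτ t ht).1).trans (le_of_eq ?_)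
    rw [(hτ s hs).2, (hτ t ht).2]
    congr 1
    ring
  · intro n z r hn s t hs hst ht htr hz
    rcases hst.eq_or_lt with rfl | hst
    · exact le_rfl
    have hs' := hτ s ⟨hs, hst.le.trans ht⟩
    have ht' := hτ t ⟨hs.trans hst.le, ht⟩
    have hlt : τ s ≤ τ t := by
      by_contra! hlt
      have := (norm_nonneg _).trans (hnorm ht'.1 hs'.1 hlt.le)
      linarith [hs'.2, ht'.2]
    refine h.form_le n hlt (hsub hs'.1 ht'.1) (fun u hu => (hB u (hsub hs'.1 ht'.1 hu)).1) ?_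
    intro u hu w hw
    have hu' := hsub hs'.1 ht'.1 hu
    refine hn _ hw ?_
    -- Up to time `τ t` the curve moves by at most the height gain `t - s ≤ r`, so from the ball of
    -- radius `r` it stays in that of radius `2 * r`.
    have h1 := hnorm hs'.1 hu' hu.1
    have h2 := (norm_nonneg _).trans (hnorm hu' ht'.1 hu.2)
    rw [Metric.mem_ball, dist_eq_norm] at hz ⊢
    have h3 := norm_sub_le_norm_sub_add_norm_sub (e (γ u)) (e (γ (τ s))) z
    linarith [hs'.2, ht'.2]

variable {B}

theorem _root_.IsConeGraph.mem_closedBall {l : E →L[ℝ] ℝ} {Γ : Set (E × E)} {h r : ℝ} {c : ℝ → E}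
    {z : E} (hc : IsConeGraph Γ l h c) (hr : h ≤ r) (h0 : c 0 ∈ Metric.closedBall z r) {s : ℝ}
    (hs : s ∈ Icc 0 h) : c s ∈ Metric.closedBall z (2 * r) := by
  rw [Metric.mem_closedBall, dist_eq_norm] at *
  have h1 := hc.norm_sub_le hs
  have h2 := norm_sub_le_norm_sub_add_norm_sub (c s) (c 0) z
  linarith [hs.2]

/-- A graph inside a box is a causal curve. -/
theorem isCausalCurve_of_isConeGraph [FiniteDimensional ℝ E] (hC : IsChartClosed C) {h : ℝ}
    {c : ℝ → E} (hc : IsConeGraph (chartCone C B.center) B.form h c) (hh : 0 < h)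
    (hB : ∀ s ∈ Icc 0 h,
      c s ∈ Metric.closedBall (chartAt E B.center B.center) (2 * B.radius)) :
    IsCausalCurve C (Icc 0 h) ((chartAt E B.center).symm ∘ c) := by
  have hLip : LipschitzOnWith 1 c (Icc 0 h) := LipschitzOnWith.of_dist_le_mul fun s hs t ht => by
    rw [dist_eq_norm, Real.dist_eq, NNReal.coe_one, one_mul]
    exact hc.lipschitz s hs t ht
  have ht : ∀ s ∈ Icc 0 h, c s ∈ (chartAt E B.center).target := fun s hs =>
    B.closedBall_subset (hB s hs)
  refine .of_near (nonempty_Icc.2 hh.le) ordConnected_Icc (fun s hs => ?_) ?_ fun hs => ?_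
  · have : IsLipschitzNear E (Icc 0 h) ((chartAt E B.center).symm ∘ c) B.center s := by
      refine ⟨((chartAt E B.center).continuousAt_symm (ht s hs)).comp_continuousWithinAt
        (hLip.continuousOn s hs), 1, Icc 0 h, self_mem_nhdsWithin, ?_⟩
      intro u hu v hv
      simp only [Function.comp_apply, (chartAt E B.center).right_inv (ht u hu),
        (chartAt E B.center).right_inv (ht v hv)]
      exact hLip hu hv
    exact this.change ((chartAt E B.center).map_target (ht s hs)) (mem_chart_source E _)
  · filter_upwards [hLip.ae_differentiableWithinAt_of_mem (μ := volume)] with s hs hsi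
    rw [interior_Icc] at hsi
    have hs' := Ioo_subset_Icc_self hsi
    have hd : DifferentiableAt ℝ c s := (hs hs').differentiableAt (Icc_mem_nhds hsi.1 hsi.2)
    rw [hasVelocity_symm_comp_iff hd (ht s hs')]
    exact hc.mem_of_hasDerivAt (hC.chart _) hsi (ht s hs') (fun w hw => B.norm_le _ hw (hB s hs'))
      hd.hasDerivAt
  · exact absurd (hs (left_mem_Icc.2 hh.le) (right_mem_Icc.2 hh.le)) hh.ne

theorem future_of_isConeGraph [FiniteDimensional ℝ E] (hC : IsChartClosed C) {h : ℝ} {c : ℝ → E}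
    (hc : IsConeGraph (chartCone C B.center) B.form h c) (hh : 0 ≤ h)
    (hB : ∀ s ∈ Icc 0 h,
      c s ∈ Metric.closedBall (chartAt E B.center B.center) (2 * B.radius))
    (h0 : (chartAt E B.center).symm (c 0) ∈ domain C) :
    (chartAt E B.center).symm (c h) ∈ future C ((chartAt E B.center).symm (c 0)) := by
  rcases hh.eq_or_lt with rfl | hh'
  · refine ⟨0, le_rfl, fun _ => (chartAt E B.center).symm (c 0), ?_, rfl, rfl⟩
    rw [Icc_self]
    exact isCausalCurve_singleton h0 0
  · exact ⟨h, hh, _, isCausalCurve_of_isConeGraph hC hc hh' hB, rfl, rfl⟩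

variable (B)

/-- A causal curve starting in the small ball either leaves the box after having gained the height
`radius`, or stays in it. -/
theorem exit [FiniteDimensional ℝ E] [T2Space M] {a b : ℝ} (hab : a ≤ b)
    (h : IsCausalCurve C (Icc a b) γ) (ha : γ a ∈ B.small) :
    (∃ t ∈ Icc a b, (∀ u ∈ Icc a t, γ u ∈ B.big) ∧ B.height (γ t) - B.height (γ a) = B.radius) ∨
      ((∀ u ∈ Icc a b, γ u ∈ B.big) ∧ B.height (γ b) - B.height (γ a) ≤ B.radius) := by
  set e := chartAt E B.center
  have ivt : ∀ t ∈ Icc a b, (∀ u ∈ Icc a t, γ u ∈ B.big) →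
      B.radius ≤ B.height (γ t) - B.height (γ a) →
      ∃ t ∈ Icc a b, (∀ u ∈ Icc a t, γ u ∈ B.big) ∧
        B.height (γ t) - B.height (γ a) = B.radius := by
    intro t ht hB hR
    have hcont := B.continuousOn_height_comp h (Icc_subset_Icc le_rfl ht.2) hB
    obtain ⟨s, hs, hsR⟩ := intermediate_value_Icc ht.1 hcont
      (show B.height (γ a) + B.radius ∈ Icc _ _ from
        ⟨by linarith [B.radius_pos], by linarith⟩)
    exact ⟨s, ⟨hs.1, hs.2.trans ht.2⟩, fun u hu => hB u ⟨hu.1, hu.2.trans hs.2⟩, by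
      simp only at hsR; linarith⟩
  let V : Set M := e.source ∩ e ⁻¹' Metric.ball (e B.center) (2 * B.radius)
  have hV : IsOpen V := e.isOpen_inter_preimage Metric.isOpen_ball
  have hVB : V ⊆ B.big := fun x hx => ⟨hx.1, Metric.ball_subset_closedBall hx.2⟩
  by_cases hA : (Icc a b ∩ γ ⁻¹' Vᶜ).Nonempty
  · have hAc : IsCompact (Icc a b ∩ γ ⁻¹' Vᶜ) :=
      isCompact_Icc.of_isClosed_subset
        (h.continuousOn.preimage_isClosed_of_isClosed isClosed_Icc hV.isClosed_compl)
        inter_subset_left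
    obtain ⟨t, ⟨ht, htV⟩, hleast⟩ := hAc.exists_isLeast hA
    have hat : a ≠ t := by
      rintro rfl
      exact htV ⟨ha.1, Metric.ball_subset_ball (by linarith [B.radius_pos]) ha.2⟩
    have hico : ∀ u ∈ Ico a t, γ u ∈ V := by
      intro u hu
      by_contra huV
      exact absurd (hleast ⟨⟨hu.1, hu.2.le.trans ht.2⟩, huV⟩) (not_le.2 hu.2)
    have hicc : ∀ u ∈ Icc a t, γ u ∈ B.big := by
      intro u hu
      rw [← closure_Ico hat] at hu
      have hcl : closure (Ico a t) ⊆ Icc a b := by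
        rw [closure_Ico hat]
        exact Icc_subset_Icc le_rfl ht.2
      have h1 := (h.continuousOn.mono hcl).image_closure (mem_image_of_mem γ hu)
      have h2 : γ '' Ico a t ⊆ B.big := by
        rintro _ ⟨v, hv, rfl⟩
        exact hVB (hico v hv)
      exact closure_minimal h2 B.isCompact_big.isClosed h1
    left
    refine ivt t ht hicc ?_
    -- At the first exit time the curve has gone from distance less than `radius` to distance at
    -- least `2 * radius` from the center; the height gain dominates this displacement.
    have h1 := B.norm_sub_le h ht.1 (Icc_subset_Icc le_rfl ht.2) hicc
    have h2 : 2 * B.radius ≤ ‖e (γ t) - e B.center‖ := by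
      by_contra! hlt
      exact htV ⟨(hicc t ⟨ht.1, le_rfl⟩).1, by rwa [mem_preimage, Metric.mem_ball, dist_eq_norm]⟩
    have h3 : ‖e (γ a) - e B.center‖ < B.radius := by
      rw [← dist_eq_norm]
      exact ha.2
    have h4 := norm_sub_le_norm_sub_add_norm_sub (e (γ t)) (e (γ a)) (e B.center)
    linarith
  · have hbig : ∀ u ∈ Icc a b, γ u ∈ B.big := fun u hu => by
      by_contra hu'
      exact hA ⟨u, hu, fun huV => hu' (hVB huV)⟩
    rcases le_total B.radius (B.height (γ b) - B.height (γ a)) with hR | hR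
    · exact Or.inl (ivt b ⟨hab, le_rfl⟩ hbig hR)
    · exact Or.inr ⟨hbig, hR⟩

end ChartBox

end Boxes

end ConeField

/-! ### Concatenation of causal curves. -/

namespace ConeField

section Concatenation

variable {E : Type*} [NormedAddCommGroup E] [NormedSpace ℝ E]
  {M : Type*} [TopologicalSpace M] [ChartedSpace E M]
  {C : Set (TangentBundle 𝓘(ℝ, E) M)} {I J : Set ℝ} {γ η : ℝ → M}

theorem IsCausalCurve.append {a b d : ℝ} (hab : a ≤ b) (hd : 0 ≤ d)
    (h₁ : IsCausalCurve C (Icc a b) γ) (h₂ : IsCausalCurve C (Icc 0 d) η) (heq : η 0 = γ b) :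
    ∃ ζ : ℝ → M, IsCausalCurve C (Icc a (b + d)) ζ ∧ EqOn ζ γ (Icc a b) ∧
      ∀ s ∈ Icc 0 d, ζ (b + s) = η s := by
  have e1 : EqOn (fun t => if t ≤ b then γ t else η (t - b)) γ (Icc a b) := fun t ht => if_pos ht.2
  have e2 : EqOn (fun t => if t ≤ b then γ t else η (t - b)) (fun t => η (t + -b))
      (Icc b (b + d)) := by
    intro t ht
    rcases ht.1.eq_or_lt with rfl | hlt
    · simp [heq]
    · simp [not_le.2 hlt, sub_eq_add_neg]
  have h₂' := h₂.comp_add (-b)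
  have hpre : (fun s => s + -b) ⁻¹' Icc 0 d = Icc b (b + d) := by
    ext t
    simp only [mem_preimage, mem_Icc]
    constructor <;> rintro ⟨h1, h2⟩ <;> constructor <;> linarith
  rw [hpre] at h₂'
  refine ⟨_, ?_, e1, fun s hs => ?_⟩
  · rw [← Icc_union_Icc_eq_Icc hab (by linarith : b ≤ b + d)]
    exact (h₁.congr e1).union (h₂'.congr e2) (isGreatest_Icc hab) (isLeast_Icc (by linarith))
  · have := e2 (show b + s ∈ Icc b (b + d) from ⟨by linarith [hs.1], by linarith [hs.2]⟩)
    simpa using this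

theorem future_trans {x y z : M} (hy : y ∈ future C x) (hz : z ∈ future C y) :
    z ∈ future C x := by
  obtain ⟨T, hT, γ, hγ, rfl, rfl⟩ := hy
  obtain ⟨S, hS, η, hη, heq, rfl⟩ := hz
  obtain ⟨ζ, hζ, h1, h2⟩ := hγ.append hT hS hη heq
  exact ⟨T + S, by linarith, ζ, hζ, h1 ⟨le_rfl, hT⟩, h2 S ⟨hS, le_rfl⟩⟩

theorem self_mem_future {x : M} (hx : x ∈ domain C) : x ∈ future C x := by
  refine ⟨0, le_rfl, fun _ => x, ?_, rfl, rfl⟩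
  rw [Icc_self]
  exact isCausalCurve_singleton hx 0

theorem IsCausalCurve.mem_future_Icc {a b : ℝ} (hab : a ≤ b) (h : IsCausalCurve C (Icc a b) γ) :
    γ b ∈ future C (γ a) := by
  refine ⟨b - a, by linarith, fun s => γ (s + a), ?_, by simp, by simp⟩
  convert! h.comp_add a using 1
  ext t
  simp only [mem_preimage, mem_Icc]
  constructor <;> rintro ⟨h1, h2⟩ <;> constructor <;> linarith

theorem isCausalCurve_concat {g : ℕ → ℝ → M} (hg : ∀ k, IsCausalCurve C (Icc 0 1) (g k))
    (heq : ∀ k, g k 1 = g (k + 1) 0) :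
    IsCausalCurve C (Ici 0) (fun t => g ⌊t⌋₊ (t - ⌊t⌋₊)) := by
  have hk : ∀ k : ℕ, IsCausalCurve C (Icc (k : ℝ) (k + 1)) (fun t => g ⌊t⌋₊ (t - ⌊t⌋₊)) := by
    intro k
    have h1 := (hg k).comp_add (-(k : ℝ))
    have hpre : (fun s => s + -(k : ℝ)) ⁻¹' Icc 0 1 = Icc (k : ℝ) (k + 1) := by
      ext t
      simp only [mem_preimage, mem_Icc]
      constructor <;> rintro ⟨h1, h2⟩ <;> constructor <;> linarith
    rw [hpre] at h1
    refine h1.congr fun t ht => ?_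
    rcases ht.2.eq_or_lt with rfl | hlt
    · have : ⌊(k : ℝ) + 1⌋₊ = k + 1 := by exact_mod_cast Nat.floor_natCast (k + 1)
      simp [this, heq k]
    · have : ⌊t⌋₊ = k := (Nat.floor_eq_iff (by linarith [ht.1, k.cast_nonneg (α := ℝ)])).2
        ⟨ht.1, hlt⟩
      simp [this, sub_eq_add_neg]
  refine isCausalCurve_Ici fun k => ?_
  induction k with
  | zero => simpa using hk 0
  | succ k ih =>
    have h1 := ih.union (by simpa using hk (k + 1)) (b := k + 1)
      (by simpa using isGreatest_Icc (by positivity : (0 : ℝ) ≤ k + 1))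
      (isLeast_Icc (by linarith))
    rw [zero_add, Icc_union_Icc_eq_Icc (by positivity) (by linarith)] at h1
    simpa using h1

theorem IsCausalCurve.not_constant (hC : IsChartClosed C) (h : IsCausalCurve C I γ) {a b : ℝ}
    (hab : a < b) (hI : Icc a b ⊆ I) (hconst : ∀ u ∈ Icc a b, γ u = γ a) : False := by
  have hne : (Ioo a b).Nonempty := nonempty_Ioo.2 hab
  have hpos : volume (Ioo a b) ≠ 0 := isOpen_Ioo.measure_ne_zero _ hne
  apply hpos
  rw [measure_eq_zero_iff_ae_notMem]
  filter_upwards [h.ae_hasVelocity] with u hu hui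
  have hn := Icc_mem_nhds hui.1 hui.2
  have h1 : HasVelocity C (fun _ => γ a) u :=
    (hu (mem_interior_iff_mem_nhds.2 (mem_of_superset hn hI))).congr
      (eventually_of_mem hn fun v hv => (hconst v hv).symm)
  refine hC.zero_notMem (γ a) ?_
  have h2 := h1.2
  rw [mfderiv_const] at h2
  exact h2

end Concatenation

/-! ### Full steps through boxes and sequences of them. -/

section Steps

variable {E : Type*} [NormedAddCommGroup E] [NormedSpace ℝ E]
  {M : Type*} [TopologicalSpace M] [ChartedSpace E M]
  {C : Set (TangentBundle 𝓘(ℝ, E) M)} {γ : ℝ → M}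

/-- From `x` in the small ball of the box, `y` is reached by a graph of height `radius`. -/
def ChartBox.Step (B : ChartBox C) (x y : M) : Prop :=
  x ∈ B.small ∧ y ∈ B.big ∧ ∃ c, IsConeGraph (chartCone C B.center) B.form B.radius c ∧
    c 0 = chartAt E B.center x ∧ c B.radius = chartAt E B.center y

theorem ChartBox.Step.height_eq {B : ChartBox C} {x y : M} (h : B.Step x y) :
    B.height y - B.height x = B.radius := by
  obtain ⟨-, -, c, hc, h0, h1⟩ := h
  have := hc.height B.radius ⟨B.radius_pos.le, le_rfl⟩
  rw [h0, h1] at this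
  simp only [height, this]
  ring

/-- A sequence of steps, each of them in the first of the boxes that contains its origin. -/
def IsStepSeq (B : ℕ → ChartBox C) (p : ℕ → M) : Prop :=
  ∀ k, ∃ n, (B n).Step (p k) (p (k + 1)) ∧ ∀ m < n, p k ∉ (B m).small

theorem exists_isStepSeq {B : ℕ → ChartBox C} (hB : ∀ x, ∃ n, x ∈ (B n).small) {P : M → Prop}
    {x : M} (hx : P x) (hP : ∀ y, P y → ∀ n, y ∈ (B n).small → ∃ z, P z ∧ (B n).Step y z) :
    ∃ p : ℕ → M, IsStepSeq B p ∧ p 0 = x ∧ ∀ k, P (p k) := by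
  classical
  have hnext : ∀ y : {y // P y}, ∃ z : {y // P y},
      ∃ n, (B n).Step y.1 z.1 ∧ ∀ m < n, y.1 ∉ (B m).small := by
    intro y
    obtain ⟨z, hz, hs⟩ := hP y.1 y.2 (Nat.find (hB y.1)) (Nat.find_spec (hB y.1))
    exact ⟨⟨z, hz⟩, _, hs, fun m hm => Nat.find_min (hB y.1) hm⟩
  choose next hnext using hnext
  refine ⟨fun k => (next^[k] ⟨x, hx⟩).1, fun k => ?_, rfl, fun k => (next^[k] ⟨x, hx⟩).2⟩
  simp only [Function.iterate_succ_apply']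
  exact hnext _

theorem exists_boxes [FiniteDimensional ℝ E] [IsManifold 𝓘(ℝ, E) ∞ M] [SecondCountableTopology M]
    [Nonempty M] (hC : IsChartClosed C) : ∃ B : ℕ → ChartBox C, ∀ x, ∃ n, x ∈ (B n).small := by
  choose B hB using ChartBox.exists_small hC
  obtain ⟨s, hs, hcover⟩ := TopologicalSpace.countable_cover_nhds
    fun x => (B x).isOpen_small.mem_nhds (hB x)
  have hne : s.Nonempty := by
    by_contra h
    rw [not_nonempty_iff_eq_empty] at h
    rw [h, biUnion_empty] at hcover
    exact empty_ne_univ hcover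
  obtain ⟨f, rfl⟩ := hs.exists_eq_range hne
  refine ⟨fun n => B (f n), fun x => ?_⟩
  have : x ∈ ⋃ y ∈ range f, (B y).small := hcover ▸ mem_univ x
  simpa using this

/-- If the points tended to `q` in the small ball of box `j`, minimality would bound the indices by
`j` eventually, and a single box `m` would serve hyperfilter-many steps. Its height is continuous at
`q`, so its increments tend to zero, yet each equals the radius of that box. -/
theorem IsStepSeq.not_tendsto [FiniteDimensional ℝ E] [T2Space M] {B : ℕ → ChartBox C}
    (hB : ∀ x, ∃ n, x ∈ (B n).small) {p : ℕ → M} (hp : IsStepSeq B p) (q : M) :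
    ¬ Tendsto p atTop (𝓝 q) := by
  intro hq
  choose n hn hmin using hp
  obtain ⟨j, hj⟩ := hB q
  have hev : ∀ᶠ k in (hyperfilter ℕ : Filter ℕ), ∃ m ∈ Iic j, n k = m := by
    have h1 := hq ((B j).isOpen_small.mem_nhds hj)
    refine Nat.hyperfilter_le_atTop ?_
    filter_upwards [h1] with k hk
    exact ⟨n k, not_lt.1 fun hlt => hmin k j hlt hk, rfl⟩
  rw [Ultrafilter.eventually_exists_mem_iff (finite_Iic j)] at hev
  obtain ⟨m, -, hm⟩ := hev
  have hlim : Tendsto p (hyperfilter ℕ) (𝓝 q) := hq.mono_left Nat.hyperfilter_le_atTop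
  have hlim' : Tendsto (fun k => p (k + 1)) (hyperfilter ℕ) (𝓝 q) :=
    (hq.comp (tendsto_add_atTop_nat 1)).mono_left Nat.hyperfilter_le_atTop
  have hqB : q ∈ (B m).big := by
    refine (B m).isCompact_big.isClosed.mem_of_tendsto hlim ?_
    filter_upwards [hm] with k hk
    exact hk ▸ (B (n k)).small_subset_big (hn k).1
  have h1 := ((B m).tendsto_height hlim' hqB).sub ((B m).tendsto_height hlim hqB)
  rw [sub_self] at h1
  have h2 : (B m).radius = 0 := by
    refine tendsto_nhds_unique (tendsto_const_nhds.congr' ?_) h1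
    filter_upwards [hm] with k hk
    subst hk
    exact (hn k).height_eq.symm
  exact (B m).radius_pos.ne' h2

variable [IsManifold 𝓘(ℝ, E) ∞ M]

theorem ChartBox.height_lt (B : ChartBox C) (hC : IsChartClosed C) {a b : ℝ} (hab : a < b)
    (h : IsCausalCurve C (Icc a b) γ) (hB : ∀ u ∈ Icc a b, γ u ∈ B.big) :
    B.height (γ a) < B.height (γ b) := by
  by_contra! hle
  refine h.not_constant hC hab Subset.rfl fun u hu => ?_
  have h1 := B.norm_sub_le h hu.1 (Icc_subset_Icc le_rfl hu.2)
    fun v hv => hB v ⟨hv.1, hv.2.trans hu.2⟩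
  have h2 := B.height_mono h hu.2 (Icc_subset_Icc hu.1 le_rfl)
    fun v hv => hB v ⟨hu.1.trans hv.1, hv.2⟩
  refine (chartAt E B.center).injOn (hB u hu).1 (hB a ⟨le_rfl, hab.le⟩).1 ?_
  rw [← sub_eq_zero, ← norm_le_zero_iff]
  linarith

variable [FiniteDimensional ℝ E]

theorem ChartBox.Step.exists_isCausalCurve (hC : IsChartClosed C) {B : ChartBox C} {x y : M}
    (h : B.Step x y) : ∃ γ : ℝ → M, IsCausalCurve C (Icc 0 1) γ ∧ γ 0 = x ∧ γ 1 = y := by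
  obtain ⟨hx, hy, c, hc, h0, h1⟩ := h
  have hcB : ∀ s ∈ Icc 0 B.radius,
      c s ∈ Metric.closedBall (chartAt E B.center B.center) (2 * B.radius) := fun s hs =>
    hc.mem_closedBall le_rfl (h0 ▸ Metric.ball_subset_closedBall hx.2) hs
  have hcur := (isCausalCurve_of_isConeGraph hC hc B.radius_pos hcB).comp_affine (C' := C)
    (β := 0) B.radius_pos.ne' fun x v hv => hC.smul_mem x _ B.radius_pos v hv
  have hpre : (fun s => B.radius * s + 0) ⁻¹' Icc 0 B.radius = Icc 0 1 := by
    ext t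
    simp only [mem_preimage, mem_Icc, add_zero]
    rw [mul_nonneg_iff_of_pos_left B.radius_pos, mul_le_iff_le_one_right B.radius_pos]
  rw [hpre] at hcur
  refine ⟨_, hcur, ?_, ?_⟩
  · simp [h0, (chartAt E B.center).left_inv hx.1]
  · simp [h1, (chartAt E B.center).left_inv hy.1]

theorem ChartBox.Step.mem_future (hC : IsChartClosed C) {B : ChartBox C} {x y : M}
    (h : B.Step x y) : y ∈ future C x := by
  obtain ⟨γ, hγ, rfl, rfl⟩ := h.exists_isCausalCurve hC
  exact ⟨1, zero_le_one, γ, hγ, rfl, rfl⟩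

/-- If no point of the future of `x` is terminal, then a full step can be made from `x`. -/
theorem ChartBox.exists_step (B : ChartBox C) (hC : IsChartClosed C) {x : M}
    (hx : x ∈ B.small) (hxD : x ∈ domain C)
    (hterm : ∀ y ∈ future C x, (strictFuture C y).Nonempty) : ∃ y, B.Step x y := by
  set e := chartAt E B.center with he
  have h0B : e x ∈ Metric.closedBall (e B.center) B.radius := Metric.ball_subset_closedBall hx.2
  -- The heights reachable by graphs from `x` form a compact set, by the limit theorem. If the
  -- largest were below `radius`, the causal curve issued from the endpoint would prolong the graph.
  let A : Set ℝ := {h | h ∈ Icc 0 B.radius ∧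
    ∃ c, IsConeGraph (chartCone C B.center) B.form h c ∧ c 0 = e x}
  have hAc : IsCompact A := by
    refine isCompact_Icc.of_isClosed_subset (isClosed_iff_ultrafilter.2 fun h 𝒰 h𝒰 hA => ?_)
      (fun h hh => hh.1)
    have hex : ∀ h, ∃ c, h ∈ A → IsConeGraph (chartCone C B.center) B.form h c ∧ c 0 = e x := by
      intro h
      by_cases hh : h ∈ A
      · obtain ⟨c, hc⟩ := hh.2
        exact ⟨c, fun _ => hc⟩
      · exact ⟨fun _ => 0, fun h' => absurd h' hh⟩
    choose c hc using hex
    obtain ⟨c', hc', h0, -⟩ := IsConeGraph.exists_limit (h := id) (c := c) (x := e x) 𝒰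
      (Filter.mem_of_superset hA fun h hh => hh.1.1)
      (Filter.mem_of_superset hA fun h hh => (hc h hh).1) h𝒰
      (tendsto_const_nhds.congr' (Filter.mem_of_superset hA fun h hh => (hc h hh).2.symm))
    exact ⟨isClosed_Icc.mem_of_tendsto (f := id) h𝒰
      (Filter.mem_of_superset hA fun h hh => hh.1), c', hc', h0⟩
  have hAn : A.Nonempty := ⟨0, ⟨le_rfl, B.radius_pos.le⟩, _, isConeGraph_zero _ _ _, rfl⟩
  obtain ⟨h, ⟨hh, c, hc, h0⟩, hmax⟩ := hAc.exists_isGreatest hAn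
  have hcB : ∀ s ∈ Icc 0 h, c s ∈ Metric.closedBall (e B.center) (2 * B.radius) := fun s hs =>
    hc.mem_closedBall hh.2 (h0 ▸ h0B) hs
  have hhh : h ∈ Icc 0 h := ⟨hh.1, le_rfl⟩
  have hct := B.closedBall_subset (hcB h hhh)
  have hx0 : e.symm (c 0) = x := by rw [h0, e.left_inv hx.1]
  rcases hh.2.eq_or_lt with rfl | hlt
  · exact ⟨e.symm (c B.radius), hx, ⟨e.map_target hct, by
      rw [mem_preimage, e.right_inv hct]; exact hcB _ hhh⟩, c, hc, h0, (e.right_inv hct).symm⟩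
  exfalso
  have hfut := future_of_isConeGraph hC hc hh.1 hcB (hx0.symm ▸ hxD)
  rw [hx0] at hfut
  obtain ⟨_, T, hT, η, hη, hη0, -⟩ := hterm _ hfut
  have heη0 : e (η 0) = c h := by rw [hη0, e.right_inv hct]
  have hηs : η 0 ∈ e.source := hη0 ▸ e.map_target hct
  -- In `V` the prolongation stays in the box and its height gain from `x` stays below `radius`, so
  -- it competes with the maximum of `A`.
  let V : Set M := e.source ∩ e ⁻¹' (Metric.ball (e B.center) (2 * B.radius) ∩
    {y | B.form y < B.form (c 0) + B.radius})
  have hV : IsOpen V := e.isOpen_inter_preimage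
    (Metric.isOpen_ball.inter (isOpen_lt B.form.continuous continuous_const))
  have hηV : η 0 ∈ V := by
    refine ⟨hηs, ?_, ?_⟩
    · have h1 := hc.norm_sub_le hhh
      have h2 : ‖c 0 - e B.center‖ < B.radius := by
        rw [h0, ← dist_eq_norm]
        exact hx.2
      have h3 := norm_sub_le_norm_sub_add_norm_sub (c h) (c 0) (e B.center)
      rw [heη0, Metric.mem_ball, dist_eq_norm]
      linarith
    · rw [heη0, mem_ofPred_eq, hc.height h hhh]
      linarith
  have h1 := hη.continuousOn 0 ⟨le_rfl, hT.le⟩ (hV.mem_nhds hηV)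
  obtain ⟨ε, hε, hεV⟩ := mem_nhdsGE_iff_exists_Icc_subset.1
    (nhdsWithin_Icc_eq_nhdsGE hT ▸ h1)
  have hδ : 0 < min ε T := lt_min hε hT
  set δ := min ε T
  have hηδ : IsCausalCurve C (Icc 0 δ) η :=
    hη.restrict hC (Icc_subset_Icc le_rfl (min_le_right _ _)) ordConnected_Icc
      (nonempty_Icc.2 hδ.le)
  have hVB : V ⊆ B.big := fun y hy => ⟨hy.1, Metric.ball_subset_closedBall hy.2.1⟩
  have hδV : ∀ u ∈ Icc 0 δ, η u ∈ V := fun u hu => hεV ⟨hu.1, hu.2.trans (min_le_left _ _)⟩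
  obtain ⟨ζ, hζ, hζx, hζb, hζB⟩ : ∃ ζ : ℝ → M, IsCausalCurve C (Icc 0 (h + δ)) ζ ∧ ζ 0 = x ∧
      ζ (h + δ) = η δ ∧ ∀ u ∈ Icc 0 (h + δ), ζ u ∈ B.big := by
    obtain ⟨γ, hγ, hγ0, hγh, hγB⟩ : ∃ γ : ℝ → M, IsCausalCurve C (Icc 0 h) γ ∧ γ 0 = x ∧
        γ h = η 0 ∧ ∀ u ∈ Icc 0 h, γ u ∈ B.big := by
      rcases hh.1.eq_or_lt with rfl | hpos
      · refine ⟨fun _ => x, ?_, rfl, by rw [hη0, hx0], fun _ _ => B.small_subset_big hx⟩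
        rw [Icc_self]
        exact isCausalCurve_singleton hxD 0
      · refine ⟨_, isCausalCurve_of_isConeGraph hC hc hpos hcB, hx0, hη0.symm, fun u hu => ?_⟩
        have hut := B.closedBall_subset (hcB u hu)
        exact ⟨e.map_target hut, by
          rw [mem_preimage, Function.comp_apply, e.right_inv hut]; exact hcB u hu⟩
    obtain ⟨ζ, hζ, h1, h2⟩ := hγ.append hh.1 hδ.le hηδ hγh.symm
    refine ⟨ζ, hζ, (h1 ⟨le_rfl, hh.1⟩).trans hγ0, h2 δ ⟨hδ.le, le_rfl⟩, fun u hu => ?_⟩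
    rcases le_total u h with huh | huh
    · rw [h1 ⟨hu.1, huh⟩]
      exact hγB u ⟨hu.1, huh⟩
    · have := h2 (u - h) ⟨by linarith, by linarith [hu.2]⟩
      rw [add_sub_cancel] at this
      rw [this]
      exact hVB (hδV _ ⟨by linarith, by linarith [hu.2]⟩)
  obtain ⟨c', hc', h0', -⟩ := B.exists_isConeGraph (by linarith [hh.1]) hζ hζB
  rw [hζx] at h0'
  rw [hζx, hζb] at hc'
  have hxh : B.height x = B.form (c 0) := by rw [h0]; rfl
  have hηh : B.height (η 0) = B.form (c 0) + h := by
    rw [← hc.height h hhh, ← heη0]; rfl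
  have h3 := B.height_lt hC hδ hηδ fun u hu => hVB (hδV u hu)
  have h4 : B.height (η δ) < B.form (c 0) + B.radius := (hδV δ ⟨hδ.le, le_rfl⟩).2.2
  have h5 := hmax (show B.height (η δ) - B.height x ∈ A from
    ⟨⟨by linarith [hh.1], by linarith⟩, c', hc', h0'⟩)
  linarith

end Steps

end ConeField

/-! ### Limits of causal curves along an ultrafilter. -/

namespace ConeField

section Limits

variable {E : Type*} [NormedAddCommGroup E] [NormedSpace ℝ E] [FiniteDimensional ℝ E]
  {M : Type*} [TopologicalSpace M] [ChartedSpace E M] [IsManifold 𝓘(ℝ, E) ∞ M]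
  {C : Set (TangentBundle 𝓘(ℝ, E) M)}

theorem ChartBox.exists_limit_graph (B : ChartBox C) {ι : Type*}
    (𝒰 : Ultrafilter ι)
    {a b : ι → ℝ} {γ : ι → ℝ → M} {x : M} {H : ℝ} (hx : x ∈ B.small)
    (hlim : Tendsto (fun i => γ i (a i)) 𝒰 (𝓝 x))
    (hγ : ∀ᶠ i in 𝒰, a i ≤ b i ∧ IsCausalCurve C (Icc (a i) (b i)) (γ i) ∧
      ∀ u ∈ Icc (a i) (b i), γ i u ∈ B.big)
    (hH : Tendsto (fun i => B.height (γ i (b i)) - B.height (γ i (a i))) 𝒰 (𝓝 H))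
    (hHR : H ≤ B.radius) :
    0 ≤ H ∧ ∃ c, IsConeGraph (chartCone C B.center) B.form H c ∧
      c 0 = chartAt E B.center x ∧
      (∀ s ∈ Icc 0 H, c s ∈ Metric.closedBall (chartAt E B.center B.center) (2 * B.radius)) ∧
      Tendsto (fun i => γ i (b i)) 𝒰 (𝓝 ((chartAt E B.center).symm (c H))) := by
  set e := chartAt E B.center
  have hex : ∀ i, ∃ c : ℝ → E, (a i ≤ b i ∧ IsCausalCurve C (Icc (a i) (b i)) (γ i) ∧
      ∀ u ∈ Icc (a i) (b i), γ i u ∈ B.big) →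
      IsConeGraph (chartCone C B.center) B.form
        (B.height (γ i (b i)) - B.height (γ i (a i))) c ∧ c 0 = e (γ i (a i)) ∧
        c (B.height (γ i (b i)) - B.height (γ i (a i))) = e (γ i (b i)) := by
    intro i
    by_cases h : a i ≤ b i ∧ IsCausalCurve C (Icc (a i) (b i)) (γ i) ∧
      ∀ u ∈ Icc (a i) (b i), γ i u ∈ B.big
    · obtain ⟨c, hc⟩ := B.exists_isConeGraph h.1 h.2.1 h.2.2
      exact ⟨c, fun _ => hc⟩
    · exact ⟨fun _ => 0, fun h' => absurd h' h⟩
  choose c hc using hex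
  have hpos : ∀ᶠ i in 𝒰, 0 ≤ B.height (γ i (b i)) - B.height (γ i (a i)) := by
    filter_upwards [hγ] with i hi
    exact sub_nonneg.2 (B.height_mono hi.2.1 hi.1 Subset.rfl hi.2.2)
  obtain ⟨c', hc', h0, h1⟩ := IsConeGraph.exists_limit 𝒰 hpos
    (hγ.mono fun i hi => (hc i hi).1) hH (x := e x)
    ((B.tendsto_chart hlim (B.small_subset_big hx)).congr' (hγ.mono fun i hi => (hc i hi).2.1.symm))
  have hH0 : 0 ≤ H := ge_of_tendsto hH hpos
  have hcB : ∀ s ∈ Icc 0 H, c' s ∈ Metric.closedBall (e B.center) (2 * B.radius) := fun s hs =>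
    hc'.mem_closedBall hHR (h0 ▸ Metric.ball_subset_closedBall hx.2) hs
  refine ⟨hH0, c', hc', h0, hcB, ?_⟩
  have ht := B.closedBall_subset (hcB H ⟨hH0, le_rfl⟩)
  refine (((e.continuousAt_symm ht).tendsto.comp h1)).congr' ?_
  filter_upwards [hγ] with i hi
  simp only [Function.comp_apply, (hc i hi).2.2]
  exact e.left_inv (hi.2.2 _ ⟨hi.1, le_rfl⟩).1

variable [T2Space M]

/-- Causal curves whose origins converge either converge to a causal curve with all of their
length, or make a full step in the limit. -/
theorem ChartBox.limit_step (hC : IsChartClosed C) (B : ChartBox C) {ι : Type*}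
    (𝒰 : Ultrafilter ι) {a b : ι → ℝ} {γ : ι → ℝ → M} {x : M} (hx : x ∈ B.small)
    (hab : ∀ i, a i ≤ b i) (hγ : ∀ i, IsCausalCurve C (Icc (a i) (b i)) (γ i))
    (hlim : Tendsto (fun i => γ i (a i)) 𝒰 (𝓝 x)) :
    (∃ z ∈ future C x, Tendsto (fun i => γ i (b i)) 𝒰 (𝓝 z)) ∨
      ∃ y, ∃ t : ι → ℝ, (∀ i, t i ∈ Icc (a i) (b i)) ∧ Tendsto (fun i => γ i (t i)) 𝒰 (𝓝 y) ∧
        B.Step x y := by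
  set e := chartAt E B.center
  have hxD : x ∈ domain C := hC.isClosed_domain.mem_of_tendsto hlim
    (Eventually.of_forall fun i => (hγ i).mem_domain hC ⟨le_rfl, hab i⟩)
  have hsm : ∀ᶠ i in (𝒰 : Filter ι), γ i (a i) ∈ B.small := hlim (B.isOpen_small.mem_nhds hx)
  -- The ultrafilter decides which alternative of `exit` prevails, without passing to a subsequence.
  have hev := hsm.mono fun i hi => B.exit (hab i) (hγ i) hi
  rw [Ultrafilter.eventually_or] at hev
  rcases hev with hev | hev
  · right
    have hex : ∀ i, ∃ t ∈ Icc (a i) (b i), (∃ t ∈ Icc (a i) (b i), (∀ u ∈ Icc (a i) t,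
        γ i u ∈ B.big) ∧ B.height (γ i t) - B.height (γ i (a i)) = B.radius) →
        (∀ u ∈ Icc (a i) t, γ i u ∈ B.big) ∧
          B.height (γ i t) - B.height (γ i (a i)) = B.radius := by
      intro i
      by_cases h : ∃ t ∈ Icc (a i) (b i), (∀ u ∈ Icc (a i) t,
        γ i u ∈ B.big) ∧ B.height (γ i t) - B.height (γ i (a i)) = B.radius
      · obtain ⟨t, ht, h1⟩ := h
        exact ⟨t, ht, fun _ => h1⟩
      · exact ⟨a i, ⟨le_rfl, hab i⟩, fun h' => absurd h' h⟩
    choose t ht htB using hex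
    obtain ⟨h0, c, hc, hc0, hcB, hct⟩ := B.exists_limit_graph 𝒰 (b := t) (H := B.radius) hx hlim
      (hev.mono fun i hi => ⟨(ht i).1, (hγ i).restrict hC (Icc_subset_Icc le_rfl (ht i).2)
        ordConnected_Icc (nonempty_Icc.2 (ht i).1), (htB i hi).1⟩)
      (tendsto_const_nhds.congr' (hev.mono fun i hi => (htB i hi).2.symm)) le_rfl
    have htgt := B.closedBall_subset (hcB _ ⟨h0, le_rfl⟩)
    refine ⟨_, t, ht, hct, hx, ⟨e.map_target htgt, ?_⟩, c, hc, hc0, (e.right_inv htgt).symm⟩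
    rw [mem_preimage, e.right_inv htgt]
    exact hcB _ ⟨h0, le_rfl⟩
  · left
    have hmem : ∀ᶠ i in 𝒰, B.height (γ i (b i)) - B.height (γ i (a i)) ∈ Icc 0 B.radius :=
      hev.mono fun i hi =>
        ⟨sub_nonneg.2 (B.height_mono (hγ i) (hab i) Subset.rfl hi.1), hi.2⟩
    obtain ⟨H, hH, hHlim⟩ := isCompact_Icc.ultrafilter_le_nhds
      (𝒰.map fun i => B.height (γ i (b i)) - B.height (γ i (a i)))
      (by rw [le_principal_iff]; exact hmem)
    obtain ⟨h0, c, hc, hc0, hcB, hct⟩ := B.exists_limit_graph 𝒰 (b := b) (H := H) hx hlim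
      (hev.mono fun i hi => ⟨hab i, hγ i, hi.1⟩) hHlim hH.2
    refine ⟨_, ?_, hct⟩
    have hx0 : e.symm (c 0) = x := by rw [hc0, e.left_inv hx.1]
    have := future_of_isConeGraph hC hc h0 hcB (hx0.symm ▸ hxD)
    rwa [hx0] at this

/-- When the endpoints have no limit in the future of `x`, the first alternative of `limit_step` is
excluded at every point reached, so full steps can be iterated. One ultrafilter serves all of them.
-/
theorem limit_or_isStepSeq (hC : IsChartClosed C) {B : ℕ → ChartBox C}
    (hB : ∀ x, ∃ n, x ∈ (B n).small) {ι : Type*}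
    (𝒰 : Ultrafilter ι) {a b : ι → ℝ} {γ : ι → ℝ → M} {x : M}
    (hab : ∀ i, a i ≤ b i) (hγ : ∀ i, IsCausalCurve C (Icc (a i) (b i)) (γ i))
    (hlim : Tendsto (fun i => γ i (a i)) 𝒰 (𝓝 x)) :
    (∃ z ∈ future C x, Tendsto (fun i => γ i (b i)) 𝒰 (𝓝 z)) ∨
      ∃ p : ℕ → M, IsStepSeq B p ∧ p 0 = x ∧ ∀ k, p k ∈ future C x ∧
        ∃ t : ι → ℝ, (∀ i, t i ∈ Icc (a i) (b i)) ∧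
          Tendsto (fun i => γ i (t i)) 𝒰 (𝓝 (p k)) := by
  by_cases hT : ∃ z ∈ future C x, Tendsto (fun i => γ i (b i)) 𝒰 (𝓝 z)
  · exact Or.inl hT
  right
  have hxD : x ∈ domain C := hC.isClosed_domain.mem_of_tendsto hlim
    (Eventually.of_forall fun i => (hγ i).mem_domain hC ⟨le_rfl, hab i⟩)
  refine exists_isStepSeq hB (P := fun y => y ∈ future C x ∧
    ∃ t : ι → ℝ, (∀ i, t i ∈ Icc (a i) (b i)) ∧ Tendsto (fun i => γ i (t i)) 𝒰 (𝓝 y))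
    ⟨self_mem_future hxD, a, fun i => ⟨le_rfl, hab i⟩, hlim⟩ ?_
  rintro y ⟨hy, t, ht, hty⟩ n hn
  rcases (B n).limit_step hC 𝒰 hn (fun i => (ht i).2) (fun i => (hγ i).restrict hC
    (Icc_subset_Icc (ht i).1 le_rfl) ordConnected_Icc (nonempty_Icc.2 (ht i).2)) hty with
    ⟨z, hz, hzl⟩ | ⟨z, s, hs, hsz, hstep⟩
  · exact absurd ⟨z, future_trans hy hz, hzl⟩ hT
  · exact ⟨z, ⟨future_trans hy (hstep.mem_future hC), s,
      fun i => ⟨(ht i).1.trans (hs i).1, (hs i).2⟩, hsz⟩, hstep⟩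

end Limits

/-! ### Rays and inextensible curves. -/

section Rays

variable {E : Type*} [NormedAddCommGroup E] [NormedSpace ℝ E]
  {M : Type*} [TopologicalSpace M] [ChartedSpace E M]
  {C : Set (TangentBundle 𝓘(ℝ, E) M)} {I J I' : Set ℝ} {γ η γ' : ℝ → M}

/-- A causal curve starting at time `0` that cannot be extended to the future: it is defined on an
unbounded interval and has no limit, or it ends at a point from which no causal curve starts. -/
structure IsRay (C : Set (TangentBundle 𝓘(ℝ, E) M)) (I : Set ℝ) (γ : ℝ → M) : Prop where
  isLeast : IsLeast I 0
  isCausalCurve : IsCausalCurve C I γ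
  terminal : (I = Ici 0 ∧ ∀ p, ¬ Tendsto γ atTop (𝓝 p)) ∨
    ∃ m, IsGreatest I m ∧ strictFuture C (γ m) = ∅

variable [IsManifold 𝓘(ℝ, E) ∞ M] [FiniteDimensional ℝ E]

/-- If `φ` stayed below `p`, then in the unbounded case it would converge to a time of `I'`, and
continuity of `γ'` would give `γ` a limit. In the terminal case `γ'` would continue from an endpoint
whose strict future is empty. -/
theorem IsRay.not_extends (hC : IsChartClosed C) (hr : IsRay C I γ)
    (hγ' : IsCausalCurve C I' γ') {φ : ℝ → ℝ}
    (hφ : StrictMonoOn φ I) (hmaps : MapsTo φ I I') (heq : ∀ t ∈ I, γ' (φ t) = γ t) {p : ℝ}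
    (hp : p ∈ I') : ∃ t ∈ I, p ≤ φ t := by
  by_contra! hlt
  rcases hr.terminal with ⟨rfl, hlim⟩ | ⟨m, hm, hempty⟩
  · let ψ : ℝ → ℝ := fun t => φ (max t 0)
    have hmem : ∀ t : ℝ, max t 0 ∈ Ici (0 : ℝ) := fun t => le_max_right t 0
    have hψm : Monotone ψ := fun s t hst =>
      hφ.monotoneOn (hmem s) (hmem t) (max_le_max_right 0 hst)
    have hbdd : BddAbove (range ψ) := ⟨p, by
      rintro _ ⟨t, rfl⟩
      exact (hlt _ (hmem t)).le⟩
    have hψ : Tendsto ψ atTop (𝓝 (⨆ t, ψ t)) := tendsto_atTop_ciSup hψm hbdd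
    have hq : (⨆ t, ψ t) ∈ I' := by
      refine hγ'.ordConnected.out (hmaps (hmem 0)) hp ⟨le_ciSup hbdd 0, ?_⟩
      exact ciSup_le fun t => (hlt _ (hmem t)).le
    have h1 : Tendsto ψ atTop (𝓝[I'] (⨆ t, ψ t)) :=
      tendsto_nhdsWithin_iff.2 ⟨hψ, Eventually.of_forall fun t => hmaps (hmem t)⟩
    refine hlim _ (((hγ'.continuousOn _ hq).tendsto.comp h1).congr' ?_)
    filter_upwards [eventually_ge_atTop 0] with t ht
    simp only [Function.comp_apply, ψ, max_eq_left ht]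
    exact heq t ht
  · have hmp := hlt m hm.1
    have h1 : IsCausalCurve C (Icc (φ m) p) γ' := hγ'.restrict hC
      (hγ'.ordConnected.out (hmaps hm.1) hp) ordConnected_Icc (nonempty_Icc.2 hmp.le)
    have h2 := h1.comp_add (φ m)
    have hpre : (fun s => s + φ m) ⁻¹' Icc (φ m) p = Icc 0 (p - φ m) := by
      ext t
      simp only [mem_preimage, mem_Icc]
      constructor <;> rintro ⟨h1, h2⟩ <;> constructor <;> linarith
    rw [hpre] at h2
    have : γ' p ∈ strictFuture C (γ m) :=
      ⟨p - φ m, by linarith, _, h2, by simp [heq m hm.1], by simp⟩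
    rw [hempty] at this
    exact this

/-- A new time of an extension lies on one side of `φ 0`; the future ray excludes one side, the past
ray, read backwards, the other. -/
theorem exists_isInextensible (hC : IsChartClosed C) (hγ : IsRay C I γ)
    (hη : IsRay (reversed C) J η) (h0 : γ 0 = η 0) :
    ∃ Γ : ℝ → M, IsInextensible C (-J ∪ I) Γ ∧ (∀ t ∈ I, Γ t = γ t) ∧ ∀ t ∈ J, Γ (-t) = η t := by
  let Γ : ℝ → M := fun t => if 0 ≤ t then γ t else η (-t)
  have e1 : ∀ t ∈ I, Γ t = γ t := fun t ht => if_pos (hγ.isLeast.2 ht)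
  have e2 : ∀ t ∈ J, Γ (-t) = η t := by
    intro t ht
    rcases (hη.isLeast.2 ht).eq_or_lt with h | h
    · rw [← h]
      simp [Γ, h0]
    · simp [Γ, h]
  have hJg : IsGreatest (-J) 0 := ⟨by simpa using hη.isLeast.1, fun t ht => by
    have := hη.isLeast.2 ht
    linarith⟩
  have hΓJ : IsCausalCurve C (-J) Γ := by
    have := hη.isCausalCurve.comp_neg
    rw [reversed_reversed] at this
    refine this.congr fun t ht => ?_
    have := e2 (-t) ht
    rwa [neg_neg] at this
  have hΓ : IsCausalCurve C (-J ∪ I) Γ := hΓJ.union (hγ.isCausalCurve.congr e1) hJg hγ.isLeast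
  refine ⟨Γ, ⟨hΓ, ?_⟩, e1, e2⟩
  rintro ⟨I', γ', φ, hγ', hφc, hφ, hsub, heq⟩
  obtain ⟨p, hp, hpφ⟩ := exists_of_ssubset hsub
  have hmaps : MapsTo φ (-J ∪ I) I' := mapsTo_iff_image_subset.2 hsub.1
  have hord : (φ '' (-J ∪ I)).OrdConnected :=
    (hΓ.ordConnected.isPreconnected.image φ hφc).ordConnected
  have hmem0 : φ 0 ∈ φ '' (-J ∪ I) := mem_image_of_mem φ (Or.inr hγ.isLeast.1)
  rcases le_total (φ 0) p with hle | hle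
  · obtain ⟨t, ht, hpt⟩ := hγ.not_extends hC hγ' (hφ.mono subset_union_right)
      (hmaps.mono_left subset_union_right) (fun t ht => (heq t (Or.inr ht)).trans (e1 t ht)) hp
    exact hpφ (hord.out hmem0 (mem_image_of_mem φ (Or.inr ht)) ⟨hle, hpt⟩)
  · obtain ⟨t, ht, hpt⟩ := hη.not_extends hC.reversed hγ'.comp_neg (φ := fun t => -φ (-t))
      (fun s hs t ht hst => neg_lt_neg (hφ (Or.inl (by simpa using ht)) (Or.inl (by simpa using hs))
        (neg_lt_neg hst)))
      (fun t ht => by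
        rw [Set.mem_neg, neg_neg]
        exact hmaps (Or.inl (by simpa using ht)))
      (fun t ht => by
        simp only [neg_neg]
        exact (heq _ (Or.inl (by simpa using ht))).trans (e2 t ht))
      (p := -p) (by simpa using hp)
    refine hpφ (hord.out (mem_image_of_mem φ (x := -t) (Or.inl (by simpa using ht))) hmem0
      ⟨by linarith, hle⟩)

theorem IsStepSeq.exists_isRay [T2Space M] (hC : IsChartClosed C) {B : ℕ → ChartBox C}
    (hB : ∀ x, ∃ n, x ∈ (B n).small) {p : ℕ → M} (hp : IsStepSeq B p) :
    ∃ γ, IsRay C (Ici 0) γ ∧ ∀ k : ℕ, γ k = p k := by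
  have hex : ∀ k, ∃ g : ℝ → M, IsCausalCurve C (Icc 0 1) g ∧ g 0 = p k ∧ g 1 = p (k + 1) := by
    intro k
    obtain ⟨n, hn, -⟩ := hp k
    exact hn.exists_isCausalCurve hC
  choose g hg hg0 hg1 using hex
  have hval : ∀ k : ℕ, g ⌊(k : ℝ)⌋₊ ((k : ℝ) - ⌊(k : ℝ)⌋₊) = p k := fun k => by
    simp [hg0]
  refine ⟨_, ⟨isLeast_Ici, isCausalCurve_concat hg fun k => (hg1 k).trans (hg0 (k + 1)).symm,
    Or.inl ⟨rfl, fun q hq => hp.not_tendsto hB q ?_⟩⟩, hval⟩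
  exact (hq.comp tendsto_natCast_atTop_atTop).congr hval

/-- No local solvability is needed: either a terminal point is in the future of `x`, and a curve to
it is a ray, or full steps can be made forever. -/
theorem exists_isRay [T2Space M] (hC : IsChartClosed C) {B : ℕ → ChartBox C}
    (hB : ∀ x, ∃ n, x ∈ (B n).small) {x : M} (hx : x ∈ domain C) :
    ∃ I γ, IsRay C I γ ∧ γ 0 = x := by
  by_cases hterm : ∃ y ∈ future C x, strictFuture C y = ∅
  · obtain ⟨_, ⟨T, hT, γ, hγ, h0, rfl⟩, hy⟩ := hterm
    exact ⟨Icc 0 T, γ, ⟨isLeast_Icc hT, hγ, Or.inr ⟨T, isGreatest_Icc hT, hy⟩⟩, h0⟩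
  · push Not at hterm
    obtain ⟨p, hp, hp0, -⟩ := exists_isStepSeq hB (P := fun y => y ∈ future C x)
      (self_mem_future hx) fun y hy n hn => by
        have hyD : y ∈ domain C := by
          obtain ⟨T, hT, γ, hγ, -, rfl⟩ := hy
          exact hγ.mem_domain hC ⟨hT, le_rfl⟩
        obtain ⟨z, hz⟩ := (B n).exists_step hC hn hyD fun z hz => hterm z (future_trans hy hz)
        exact ⟨z, future_trans hy (hz.mem_future hC), hz⟩
    obtain ⟨γ, hγ, hγp⟩ := hp.exists_isRay hC hB
    exact ⟨_, γ, hγ, by simpa [hp0] using hγp 0⟩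

end Rays

end ConeField

/-! ### Time reversal. -/

namespace ConeField

section Reversal

variable {E : Type*} [NormedAddCommGroup E] [NormedSpace ℝ E]
  {M : Type*} [TopologicalSpace M] [ChartedSpace E M]
  {C : Set (TangentBundle 𝓘(ℝ, E) M)} {I J : Set ℝ} {γ η : ℝ → M}

theorem IsCausalCurve.comp_sub {a b : ℝ} (h : IsCausalCurve C (Icc a b) γ) :
    IsCausalCurve (reversed C) (Icc 0 (b - a)) (fun s => γ (b - s)) := by
  have h1 := h.comp_affine (C' := reversed C) (α := -1) (β := b) (by norm_num) fun x v hv => by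
    rw [mem_fiber_reversed, neg_smul, one_smul, neg_neg]
    exact hv
  have hpre : (fun s => -1 * s + b) ⁻¹' Icc a b = Icc 0 (b - a) := by
    ext t
    simp only [mem_preimage, mem_Icc]
    constructor <;> rintro ⟨h1, h2⟩ <;> constructor <;> linarith
  rw [hpre] at h1
  convert! h1 using 3
  ring

theorem mem_future_of_reversed {x y : M} (h : y ∈ future (reversed C) x) : x ∈ future C y := by
  obtain ⟨T, hT, γ, hγ, rfl, rfl⟩ := h
  have := hγ.comp_sub
  rw [reversed_reversed, sub_zero] at this
  exact ⟨T, hT, _, this, by simp, by simp⟩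

theorem mem_strictFuture_reversed {x y : M} (h : y ∈ strictFuture C x) :
    x ∈ strictFuture (reversed C) y := by
  obtain ⟨T, hT, γ, hγ, rfl, rfl⟩ := h
  have := hγ.comp_sub
  rw [sub_zero] at this
  exact ⟨T, hT, _, this, by simp, by simp⟩

theorem IsLocallySolvable.reversed (h : IsLocallySolvable C) :
    IsLocallySolvable (reversed C) := by
  intro x hx
  rw [domain_reversed] at hx
  obtain ⟨γ, hγ, h0, s, hs, t, ht, hst⟩ := h x hx
  have h1 := hγ.comp_neg
  have hpre : -Ioo (-1 : ℝ) 1 = Ioo (-1) 1 := by simp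
  rw [hpre] at h1
  refine ⟨_, h1, by simpa using h0, -s, ?_, -t, ?_, by simpa using hst⟩
  · exact ⟨by linarith [hs.2], by linarith [hs.1]⟩
  · exact ⟨by linarith [ht.2], by linarith [ht.1]⟩

end Reversal

/-! ### Rays on a half line. -/

section Solvable

variable {E : Type*} [NormedAddCommGroup E] [NormedSpace ℝ E]
  {M : Type*} [TopologicalSpace M] [ChartedSpace E M]
  {C : Set (TangentBundle 𝓘(ℝ, E) M)} {I J : Set ℝ} {γ η : ℝ → M}

theorem IsRay.prepend {ρ : ℝ → M} {T : ℝ} (hT : 0 ≤ T) (hγ : IsCausalCurve C (Icc 0 T) γ)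
    (hρ : IsRay C (Ici 0) ρ) (heq : ρ 0 = γ T) :
    ∃ ρ', IsRay C (Ici 0) ρ' ∧ EqOn ρ' γ (Icc 0 T) := by
  let Γ : ℝ → M := fun t => if t ≤ T then γ t else ρ (t + -T)
  have e1 : EqOn Γ γ (Icc 0 T) := fun t ht => if_pos ht.2
  have e2 : EqOn Γ (fun t => ρ (t + -T)) (Ici T) := by
    intro t ht
    rcases (mem_Ici.1 ht).eq_or_lt with rfl | hlt
    · simp [Γ, heq]
    · simp [Γ, not_le.2 hlt]
  have h2 := hρ.isCausalCurve.comp_add (-T)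
  have hpre : (fun s => s + -T) ⁻¹' Ici 0 = Ici T := by
    ext t
    simp
  rw [hpre] at h2
  have hc := (hγ.congr e1).union (h2.congr e2) (isGreatest_Icc hT) isLeast_Ici
  rw [Icc_union_Ici_eq_Ici hT] at hc
  refine ⟨Γ, ⟨isLeast_Ici, hc, Or.inl ⟨rfl, fun p hp => ?_⟩⟩, e1⟩
  rcases hρ.terminal with ⟨-, hlim⟩ | ⟨m, hm, -⟩
  · refine hlim p ((hp.comp (tendsto_atTop_add_const_right _ T tendsto_id)).congr' ?_)
    filter_upwards [eventually_ge_atTop 0] with t ht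
    simpa using e2 (show t + T ∈ Ici T by simpa using ht)
  · exact absurd (hm.2 (show m + 1 ∈ Ici 0 from by
      have := hm.1
      simp only [mem_Ici] at this ⊢
      linarith)) (by linarith)

/-- Running again and again through a closed causal curve. -/
theorem exists_isRay_of_mem_strictFuture [T2Space M] (hC : IsChartClosed C) {x : M}
    (hx : x ∈ strictFuture C x) : ∃ ρ, IsRay C (Ici 0) ρ ∧ ∀ k : ℕ, ρ k = x := by
  obtain ⟨T, hT, γ, hγ, h0, h1⟩ := hx
  have hg := hγ.comp_affine (C' := C) (β := 0) hT.ne' fun x v hv => hC.smul_mem x T hT v hv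
  have hpre : (fun s => T * s + 0) ⁻¹' Icc 0 T = Icc 0 1 := by
    ext t
    simp only [mem_preimage, mem_Icc, add_zero]
    rw [mul_nonneg_iff_of_pos_left hT, mul_le_iff_le_one_right hT]
  rw [hpre] at hg
  simp only [add_zero] at hg
  set g : ℝ → M := fun s => γ (T * s) with hgdef
  have hg0 : g 0 = x := by simp [hgdef, h0]
  have hg1 : g 1 = x := by simp [hgdef, h1]
  refine ⟨_, ⟨isLeast_Ici, isCausalCurve_concat (g := fun _ => g) (fun _ => hg)
    (fun _ => hg1.trans hg0.symm), Or.inl ⟨rfl, fun q hq => ?_⟩⟩, fun k => by simp [hg0]⟩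
  -- A limit of the periodic curve, sampled at the times `k + s`, equals `g s` for every `s`, so the
  -- loop would be constant.
  have hval : ∀ s ∈ Ico (0 : ℝ) 1, Tendsto (fun _ : ℕ => g s) atTop (𝓝 q) := by
    intro s hs
    refine (hq.comp (tendsto_atTop_add_const_right _ s tendsto_natCast_atTop_atTop)).congr ?_
    intro k
    have : ⌊(k : ℝ) + s⌋₊ = k :=
      (Nat.floor_eq_iff (by linarith [k.cast_nonneg (α := ℝ), hs.1])).2
        ⟨by linarith [hs.1], by linarith [hs.2]⟩
    simp [this]
  have hconst : ∀ s ∈ Icc (0 : ℝ) 1, g s = q := by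
    intro s hs
    rcases hs.2.eq_or_lt with rfl | hlt
    · rw [hg1, ← hg0]
      exact tendsto_nhds_unique tendsto_const_nhds (hval 0 ⟨le_rfl, one_pos⟩)
    · exact tendsto_nhds_unique tendsto_const_nhds (hval s ⟨hs.1, hlt⟩)
  exact hg.not_constant hC one_pos Subset.rfl fun u hu =>
    (hconst u hu).trans (hconst 0 ⟨le_rfl, zero_le_one⟩).symm

theorem IsLocallySolvable.strictFuture_nonempty [IsManifold 𝓘(ℝ, E) ∞ M] [FiniteDimensional ℝ E]
    (hC : IsChartClosed C) (hs : IsLocallySolvable C) {x : M} (hx : x ∈ domain C) :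
    (strictFuture C x).Nonempty := by
  obtain ⟨γ, hγ, h0, -⟩ := hs x hx
  refine ⟨γ (1 / 2), 1 / 2, by norm_num, γ, hγ.restrict hC ?_ ordConnected_Icc ?_, h0, rfl⟩
  · exact fun t ht => ⟨by linarith [ht.1], by linarith [ht.2]⟩
  · exact nonempty_Icc.2 (by norm_num)

/-- A Cauchy subset is tested only on curves defined on `ℝ`; this is where local solvability is used
to discard rays with a terminal endpoint. -/
theorem IsRay.eq_Ici [IsManifold 𝓘(ℝ, E) ∞ M] [FiniteDimensional ℝ E]
    (hC : IsChartClosed C) (hs : IsLocallySolvable C) (hr : IsRay C I γ) : I = Ici 0 := by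
  rcases hr.terminal with ⟨h, -⟩ | ⟨m, hm, hempty⟩
  · exact h
  · have := hs.strictFuture_nonempty hC (hr.isCausalCurve.mem_domain hC hm.1)
    rw [hempty] at this
    exact absurd this not_nonempty_empty

theorem exists_isInextensible_univ [IsManifold 𝓘(ℝ, E) ∞ M] [FiniteDimensional ℝ E]
    (hC : IsChartClosed C)
    (hγ : IsRay C (Ici 0) γ) (hη : IsRay (ConeField.reversed C) (Ici 0) η) (h0 : γ 0 = η 0) :
    ∃ Γ : ℝ → M, IsInextensible C univ Γ ∧ (∀ t, 0 ≤ t → Γ t = γ t) ∧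
      ∀ t, 0 ≤ t → Γ (-t) = η t := by
  have := exists_isInextensible hC hγ hη h0
  have huniv : -Ici (0 : ℝ) ∪ Ici 0 = univ := by
    rw [Set.neg_Ici, neg_zero, Iic_union_Ici]
  rwa [huniv] at this

end Solvable

/-! ### The two sides of a Cauchy subset. -/

section CauchyPair

variable {E : Type*} [NormedAddCommGroup E] [NormedSpace ℝ E]
  {M : Type*} [TopologicalSpace M] [ChartedSpace E M] {C : Set (TangentBundle 𝓘(ℝ, E) M)}

/-- Two sets separated by a Cauchy subset: inextensible curves go from `P` to `F`. -/
structure IsCauchyPair (C : Set (TangentBundle 𝓘(ℝ, E) M)) (P F : Set M) : Prop where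
  past_nhds : ∀ x ∈ P, ∃ O ∈ 𝓝 x, O ∩ domain C ⊆ P
  future_nhds : ∀ x ∈ F, ∃ O ∈ 𝓝 x, O ∩ domain C ⊆ F
  curve : ∀ γ : ℝ → M, IsInextensible C univ γ → ∃ a b : ℝ, (∀ t < a, γ t ∈ P) ∧
    (∀ t > b, γ t ∈ F) ∧ ∀ s t, s ≤ t → γ s ∈ F → γ t ∉ P

theorem IsCauchySubset.exists_isCauchyPair {H : Set M} (hH : IsCauchySubset C H) :
    ∃ P F, IsCauchyPair C P F := by
  obtain ⟨N, hN, F, P, ⟨O, hO, rfl⟩, ⟨O', hO', rfl⟩, -, hFP, hFH, hPH, hcurve⟩ := hH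
  have hDN := subset_of_mem_nhdsSet hN
  refine ⟨N ∩ O', N ∩ O, ⟨fun x hx => ⟨O', hO'.mem_nhds hx.2, fun y hy => ⟨hDN hy.2, hy.1⟩⟩,
    fun x hx => ⟨O, hO.mem_nhds hx.2, fun y hy => ⟨hDN hy.2, hy.1⟩⟩, fun γ hγ => ?_⟩⟩
  obtain ⟨a, b, hab, hP, hF, hmid⟩ := hcurve γ hγ
  refine ⟨a, b, hP, hF, fun s t hst hs ht => ?_⟩
  -- Up to time `b` the curve is in `Uminus` or in `H`, both disjoint from `Uplus`.
  have hbs : b < s := by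
    by_contra! hsb
    rcases lt_or_ge s a with hsa | has
    · exact disjoint_left.1 hFP hs (hP s hsa)
    · exact disjoint_left.1 hFH hs ⟨hs.1, hmid s ⟨has, hsb⟩⟩
  exact disjoint_left.1 hFP (hF t (hbs.trans_le hst)) ht

/-- Along an inextensible curve the zeros of the monotone function `τ ∘ γ` form a nonempty closed
set, trapped between times where the values are `-1` and `1`; its extreme points are `a` and `b`. -/
theorem IsCauchyCausalFunction.isCauchySubset {τ : M → ℝ} (hτ : IsCauchyCausalFunction C τ) :
    IsCauchySubset C {x | τ x = 0} := by
  refine ⟨univ, univ_mem, {x | 0 < τ x}, {x | τ x < 0},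
    ⟨{x | 0 < τ x}, isOpen_lt continuous_const hτ.1.1, (univ_inter _).symm⟩,
    ⟨{x | τ x < 0}, isOpen_lt hτ.1.1 continuous_const, (univ_inter _).symm⟩,
    ?_, ?_, ?_, ?_, fun γ hγ => ?_⟩
  · ext x
    simp only [univ_inter, mem_union, mem_ofPred_eq, mem_univ, iff_true]
    rcases lt_trichotomy (τ x) 0 with h | h | h <;> simp [h]
  · exact disjoint_left.2 fun x (h : 0 < τ x) (h' : τ x < 0) => lt_asymm h h'
  · exact disjoint_left.2 fun x (h : 0 < τ x) h' => h.ne' h'.2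
  · exact disjoint_left.2 fun x (h : τ x < 0) h' => h.ne h'.2
  have hmono : Monotone fun t => τ (γ t) := monotoneOn_univ.1 (hτ.1.2 _ _ hγ.1)
  have hcont : Continuous fun t => τ (γ t) :=
    hτ.1.1.comp (continuousOn_univ.1 hγ.1.continuousOn)
  obtain ⟨t₀, -, h₀⟩ := hτ.2 _ _ hγ (mem_univ 0)
  obtain ⟨t₁, -, h₁⟩ := hτ.2 _ _ hγ (mem_univ 1)
  obtain ⟨t₂, -, h₂⟩ := hτ.2 _ _ hγ (mem_univ (-1))
  simp only at h₀ h₁ h₂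
  let Z : Set ℝ := {t | τ (γ t) = 0}
  have hZ : Z ⊆ Icc t₂ t₁ := by
    intro t (ht : τ (γ t) = 0)
    constructor
    · by_contra! hlt
      have := hmono hlt.le
      simp only [ht, h₂] at this
      linarith
    · by_contra! hlt
      have := hmono hlt.le
      simp only [ht, h₁] at this
      linarith
  have hZc : IsCompact Z :=
    isCompact_Icc.of_isClosed_subset (isClosed_eq hcont continuous_const) hZ
  obtain ⟨a, ha⟩ := hZc.exists_isLeast ⟨t₀, h₀⟩
  obtain ⟨b, hb⟩ := hZc.exists_isGreatest ⟨t₀, h₀⟩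
  have ha0 : τ (γ a) = 0 := ha.1
  have hb0 : τ (γ b) = 0 := hb.1
  refine ⟨a, b, ha.2 hb.1, fun t ht => ?_, fun t ht => ?_, fun t ht => ?_⟩
  · have h1 : τ (γ t) ≤ τ (γ a) := hmono ht.le
    refine lt_of_le_of_ne (h1.trans ha0.le) fun h => ?_
    exact absurd (ha.2 h) (not_le.2 ht)
  · have h1 : τ (γ b) ≤ τ (γ t) := hmono (le_of_lt ht)
    refine lt_of_le_of_ne (hb0.ge.trans h1) fun h => ?_
    exact absurd (hb.2 h.symm) (not_le.2 ht)
  · have h1 : τ (γ a) ≤ τ (γ t) := hmono ht.1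
    have h2 : τ (γ t) ≤ τ (γ b) := hmono ht.2
    exact le_antisymm (h2.trans hb0.le) (ha0.ge.trans h1)

end CauchyPair

/-! ### Causality and compactness from a Cauchy pair. -/

section CauchySubset

variable {E : Type*} [NormedAddCommGroup E] [NormedSpace ℝ E] [FiniteDimensional ℝ E]
  {M : Type*} [TopologicalSpace M] [T2Space M] [SecondCountableTopology M] [ChartedSpace E M]
  [IsManifold 𝓘(ℝ, E) ∞ M] {C : Set (TangentBundle 𝓘(ℝ, E) M)}

theorem exists_isRay_Ici (hC : IsChartClosed C) (hs : IsLocallySolvable C) {x : M}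
    (hx : x ∈ domain C) : ∃ γ, IsRay C (Ici 0) γ ∧ γ 0 = x := by
  have : Nonempty M := ⟨x⟩
  obtain ⟨B, hB⟩ := exists_boxes hC
  obtain ⟨I, γ, hγ, h0⟩ := exists_isRay hC hB hx
  have := hγ.eq_Ici hC hs
  subst this
  exact ⟨γ, hγ, h0⟩

namespace IsCauchyPair

variable {P F : Set M} (h : IsCauchyPair C P F) (hC : IsChartClosed C) (hs : IsLocallySolvable C)

include h hC hs

/-- The causal curve from `x` to `y` is completed by rays at both ends to an inextensible curve on
`ℝ`, to which the order condition of the pair applies. -/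
theorem notMem_of_future {x y : M} (hx : x ∈ F) (hy : y ∈ future C x) : y ∉ P := by
  obtain ⟨T, hT, γ, hγ, rfl, rfl⟩ := hy
  obtain ⟨ρ, hρ, hρ0⟩ := exists_isRay_Ici hC hs (hγ.mem_domain hC (right_mem_Icc.2 hT))
  obtain ⟨ρ', hρ', heq⟩ := hρ.prepend hT hγ hρ0
  obtain ⟨η, hη, hη0⟩ := exists_isRay_Ici hC.reversed hs.reversed
    (x := γ 0) (by rw [domain_reversed]; exact hγ.mem_domain hC (left_mem_Icc.2 hT))
  have h0 := heq (left_mem_Icc.2 hT)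
  obtain ⟨Γ, hΓ, h1, -⟩ := exists_isInextensible_univ hC hρ' hη (h0.trans hη0.symm)
  obtain ⟨-, -, -, -, hord⟩ := h.curve Γ hΓ
  have := hord 0 T hT
  rw [h1 0 le_rfl, h1 T hT, h0, heq (right_mem_Icc.2 hT)] at this
  exact this hx

theorem exists_mem_future_of_isStepSeq {B : ℕ → ChartBox C} (hB : ∀ x, ∃ n, x ∈ (B n).small)
    {p : ℕ → M} (hp : IsStepSeq B p) : ∃ k, p k ∈ F := by
  obtain ⟨ρ, hρ, hρp⟩ := hp.exists_isRay hC hB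
  obtain ⟨η, hη, hη0⟩ := exists_isRay_Ici hC.reversed hs.reversed
    (x := ρ 0) (by rw [domain_reversed]; exact hρ.isCausalCurve.mem_domain hC self_mem_Ici)
  obtain ⟨Γ, hΓ, h1, -⟩ := exists_isInextensible_univ hC hρ hη hη0.symm
  obtain ⟨-, b, -, hF, -⟩ := h.curve Γ hΓ
  obtain ⟨k, hk⟩ := exists_nat_gt b
  exact ⟨k, by rw [← hρp, ← h1 k k.cast_nonneg]; exact hF k hk⟩

theorem exists_mem_past_of_isStepSeq {B : ℕ → ChartBox (reversed C)}
    (hB : ∀ x, ∃ n, x ∈ (B n).small) {p : ℕ → M} (hp : IsStepSeq B p) : ∃ k, p k ∈ P := by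
  obtain ⟨η, hη, hηp⟩ := hp.exists_isRay hC.reversed hB
  obtain ⟨ρ, hρ, hρ0⟩ := exists_isRay_Ici hC hs
    (x := η 0) (by rw [← domain_reversed]; exact hη.isCausalCurve.mem_domain hC.reversed self_mem_Ici)
  obtain ⟨Γ, hΓ, -, h1⟩ := exists_isInextensible_univ hC hρ hη hρ0
  obtain ⟨a, -, hP, -, -⟩ := h.curve Γ hΓ
  obtain ⟨k, hk⟩ := exists_nat_gt (-a)
  exact ⟨k, by rw [← hηp, ← h1 k k.cast_nonneg]; exact hP _ (by linarith)⟩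

theorem isCausal : IsCausal C := by
  intro x hx
  obtain ⟨ρ, hρ, hρx⟩ := exists_isRay_of_mem_strictFuture hC hx
  obtain ⟨η, hη, hηx⟩ := exists_isRay_of_mem_strictFuture hC.reversed (mem_strictFuture_reversed hx)
  obtain ⟨Γ, hΓ, h1, h2⟩ := exists_isInextensible_univ hC hρ hη
    (by simpa using (hρx 0).trans (hηx 0).symm)
  obtain ⟨a, b, hP, hF, -⟩ := h.curve Γ hΓ
  obtain ⟨k, hk⟩ := exists_nat_gt b
  obtain ⟨j, hj⟩ := exists_nat_gt (-a)
  have hxF : x ∈ F := by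
    rw [← hρx k, ← h1 k k.cast_nonneg]
    exact hF k hk
  have hxP : x ∈ P := by
    rw [← hηx j, ← h2 j j.cast_nonneg]
    exact hP _ (by linarith)
  obtain ⟨T, hT, γ, hγ, h0, -⟩ := hx
  refine h.notMem_of_future hC hs hxF (self_mem_future ?_) hxP
  exact h0 ▸ hγ.mem_domain hC (left_mem_Icc.2 hT.le)

variable {ι : Type*} (𝒰 : Ultrafilter ι) {a b : ι → ℝ} {γ : ι → ℝ → M}

/-- The limit ray enters `F` at some vertex; since `F` is open relative to the domain and causal
curves stay in the domain, the approximating curves are eventually in `F` as well. -/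
theorem limit_forward (hab : ∀ i, a i ≤ b i) (hγ : ∀ i, IsCausalCurve C (Icc (a i) (b i)) (γ i))
    {x : M} (hlim : Tendsto (fun i => γ i (a i)) 𝒰 (𝓝 x)) :
    (∃ z ∈ future C x, Tendsto (fun i => γ i (b i)) 𝒰 (𝓝 z)) ∨
      ∃ p ∈ future C x, ∃ t : ι → ℝ, (∀ i, t i ∈ Icc (a i) (b i)) ∧
        Tendsto (fun i => γ i (t i)) 𝒰 (𝓝 p) ∧ ∀ᶠ i in 𝒰, γ i (t i) ∈ F := by
  have : Nonempty M := ⟨x⟩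
  obtain ⟨B, hB⟩ := exists_boxes hC
  refine (limit_or_isStepSeq hC hB 𝒰 hab hγ hlim).imp_right ?_
  rintro ⟨p, hp, -, hpt⟩
  obtain ⟨k, hk⟩ := h.exists_mem_future_of_isStepSeq hC hs hB hp
  obtain ⟨hf, t, ht, htp⟩ := hpt k
  obtain ⟨O, hO, hOF⟩ := h.future_nhds _ hk
  refine ⟨p k, hf, t, ht, htp, ?_⟩
  filter_upwards [htp hO] with i hi
  exact hOF ⟨hi, (hγ i).mem_domain hC (ht i)⟩

theorem limit_backward (hab : ∀ i, a i ≤ b i) (hγ : ∀ i, IsCausalCurve C (Icc (a i) (b i)) (γ i))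
    {z : M} (hlim : Tendsto (fun i => γ i (b i)) 𝒰 (𝓝 z)) :
    (∃ x, z ∈ future C x ∧ Tendsto (fun i => γ i (a i)) 𝒰 (𝓝 x)) ∨
      ∃ t : ι → ℝ, (∀ i, t i ∈ Icc (a i) (b i)) ∧ ∀ᶠ i in 𝒰, γ i (t i) ∈ P := by
  have : Nonempty M := ⟨z⟩
  obtain ⟨B, hB⟩ := exists_boxes hC.reversed
  rcases limit_or_isStepSeq hC.reversed hB 𝒰 (γ := fun i s => γ i (b i - s)) (a := fun _ => 0)
    (b := fun i => b i - a i) (x := z) (fun i => sub_nonneg.2 (hab i)) (fun i => (hγ i).comp_sub)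
    (by simpa using hlim) with ⟨x, hx, hxl⟩ | ⟨p, hp, -, hpt⟩
  · exact Or.inl ⟨x, mem_future_of_reversed hx, by simpa using hxl⟩
  · right
    obtain ⟨k, hk⟩ := h.exists_mem_past_of_isStepSeq hC hs hB hp
    obtain ⟨-, t, ht, htp⟩ := hpt k
    obtain ⟨O, hO, hOP⟩ := h.past_nhds _ hk
    have ht' : ∀ i, b i - t i ∈ Icc (a i) (b i) := fun i =>
      ⟨by linarith [(ht i).2], by linarith [(ht i).1]⟩
    refine ⟨fun i => b i - t i, ht', ?_⟩
    filter_upwards [htp hO] with i hi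
    exact hOP ⟨hi, (hγ i).mem_domain hC (ht' i)⟩

/-- A backward limit cannot escape to the past once the curves have met `F`. -/
theorem limit_backward_of_mem
    (hγ : ∀ i, IsCausalCurve C (Icc (a i) (b i)) (γ i))
    {z : M} (hlim : Tendsto (fun i => γ i (b i)) 𝒰 (𝓝 z)) {u : ι → ℝ}
    (hu : ∀ i, u i ∈ Icc (a i) (b i)) {t : ι → ℝ} (ht : ∀ i, t i ∈ Icc (a i) (u i))
    (hF : ∀ᶠ i in 𝒰, γ i (t i) ∈ F) :
    ∃ x, z ∈ future C x ∧ Tendsto (fun i => γ i (u i)) 𝒰 (𝓝 x) := by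
  refine (h.limit_backward hC hs 𝒰 (fun i => (hu i).2) (fun i => (hγ i).restrict hC
    (Icc_subset_Icc (hu i).1 le_rfl) ordConnected_Icc (nonempty_Icc.2 (hu i).2)) hlim).resolve_right
    ?_
  rintro ⟨s, hs', hP⟩
  obtain ⟨i, hiP, hiF⟩ := (hP.and hF).exists
  have hts : t i ≤ s i := (ht i).2.trans (hs' i).1
  refine h.notMem_of_future hC hs hiF ?_ hiP
  exact ((hγ i).restrict hC (Icc_subset_Icc (ht i).1 (hs' i).2) ordConnected_Icc
    (nonempty_Icc.2 hts)).mem_future_Icc hts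

/-- If the forward limit breaks down, it still reaches a point `p` near which the curves are in `F`.
The backward limit from `z` down to those times then cannot break down, and joins `p` to `z`. -/
theorem mem_future_of_tendsto (hab : ∀ i, a i ≤ b i)
    (hγ : ∀ i, IsCausalCurve C (Icc (a i) (b i)) (γ i)) {x z : M}
    (hx : Tendsto (fun i => γ i (a i)) 𝒰 (𝓝 x)) (hz : Tendsto (fun i => γ i (b i)) 𝒰 (𝓝 z)) :
    z ∈ future C x := by
  rcases h.limit_forward hC hs 𝒰 hab hγ hx with ⟨z', hz', hlim⟩ | ⟨p, hp, t, ht, htp, hF⟩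
  · exact tendsto_nhds_unique hlim hz ▸ hz'
  · obtain ⟨p', hp', hlim⟩ := h.limit_backward_of_mem hC hs 𝒰 hγ hz ht
      (t := t) (fun i => ⟨(ht i).1, le_rfl⟩) hF
    exact future_trans hp (tendsto_nhds_unique hlim htp ▸ hp')

/-- Either the forward limit from `x` reaches the times `u i`, or the curves meet `F` before them,
and then the backward limit from `z` reaches them. -/
theorem exists_tendsto (hγ : ∀ i, IsCausalCurve C (Icc (a i) (b i)) (γ i)) {x z : M}
    (hx : Tendsto (fun i => γ i (a i)) 𝒰 (𝓝 x)) (hz : Tendsto (fun i => γ i (b i)) 𝒰 (𝓝 z))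
    {u : ι → ℝ} (hu : ∀ i, u i ∈ Icc (a i) (b i)) :
    ∃ y, Tendsto (fun i => γ i (u i)) 𝒰 (𝓝 y) := by
  rcases h.limit_forward hC hs 𝒰 (fun i => (hu i).1) (fun i => (hγ i).restrict hC
    (Icc_subset_Icc le_rfl (hu i).2) ordConnected_Icc (nonempty_Icc.2 (hu i).1)) hx with
    ⟨y, -, hlim⟩ | ⟨p, hp, t, ht, -, hF⟩
  · exact ⟨y, hlim⟩
  · obtain ⟨y, -, hlim⟩ := h.limit_backward_of_mem hC hs 𝒰 hγ hz hu ht hF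
    exact ⟨y, hlim⟩

theorem isCompact_inter {K K' : Set M} (hK : IsCompact K) (hK' : IsCompact K') :
    IsCompact (futureOf C K ∩ pastOf C K') := by
  rw [isCompact_iff_ultrafilter_le_nhds]
  intro f hf
  set S := futureOf C K ∩ pastOf C K' with hS
  have hex : ∀ y : S, ∃ x ∈ K, ∃ z ∈ K', ∃ (b u : ℝ) (γ : ℝ → M), 0 ≤ b ∧ u ∈ Icc 0 b ∧
      IsCausalCurve C (Icc 0 b) γ ∧ γ 0 = x ∧ γ u = y ∧ γ b = z := by
    rintro ⟨y, hy, hy'⟩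
    simp only [futureOf, pastOf, past, mem_iUnion, mem_ofPred_eq, exists_prop] at hy hy'
    obtain ⟨x, hx, T, hT, γ, hγ, h0, h1⟩ := hy
    obtain ⟨z, hz, T', hT', γ', hγ', h0', h1'⟩ := hy'
    obtain ⟨ζ, hζ, e1, e2⟩ := hγ.append hT hT' hγ' (h0'.trans h1.symm)
    exact ⟨x, hx, z, hz, T + T', T, ζ, by linarith, ⟨hT, by linarith⟩, hζ,
      (e1 (left_mem_Icc.2 hT)).trans h0, (e1 (right_mem_Icc.2 hT)).trans h1,
      (e2 T' (right_mem_Icc.2 hT')).trans h1'⟩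
  choose x hx z hz b u γ hb hu hγ h0 h1 h2 using hex
  have hSf : range ((↑) : S → M) ∈ f := by
    rw [Subtype.range_coe]
    exact le_principal_iff.1 hf
  -- Points of `S` index their own chosen curves; the ultrafilter pulled back to `S` makes both
  -- endpoints converge in `K` and `K'`.
  let 𝒰 : Ultrafilter S := f.comap Subtype.coe_injective hSf
  obtain ⟨x₀, hx₀, hxl⟩ := hK.ultrafilter_le_nhds (𝒰.map x)
    (by rw [le_principal_iff]; exact Eventually.of_forall (f := (𝒰 : Filter S)) hx)
  obtain ⟨z₀, hz₀, hzl⟩ := hK'.ultrafilter_le_nhds (𝒰.map z)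
    (by rw [le_principal_iff]; exact Eventually.of_forall (f := (𝒰 : Filter S)) hz)
  have hxl' : Tendsto (fun i => γ i 0) 𝒰 (𝓝 x₀) := by
    simp only [h0]
    exact hxl
  have hzl' : Tendsto (fun i => γ i (b i)) 𝒰 (𝓝 z₀) := by
    simp only [h2]
    exact hzl
  obtain ⟨y, hy⟩ := h.exists_tendsto hC hs 𝒰 hγ hxl' hzl' hu
  have hy1 := h.mem_future_of_tendsto hC hs 𝒰 (fun i => (hu i).1) (fun i => (hγ i).restrict hC
    (Icc_subset_Icc le_rfl (hu i).2) ordConnected_Icc (nonempty_Icc.2 (hu i).1)) hxl' hy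
  have hy2 := h.mem_future_of_tendsto hC hs 𝒰 (fun i => (hu i).2) (fun i => (hγ i).restrict hC
    (Icc_subset_Icc (hu i).1 le_rfl) ordConnected_Icc (nonempty_Icc.2 (hu i).2)) hy hzl'
  refine ⟨y, ⟨mem_biUnion hx₀ hy1, mem_biUnion hz₀ hy2⟩, ?_⟩
  simp only [h1] at hy
  have hmap : Filter.map ((↑) : S → M) 𝒰 = f := Filter.map_comap_of_mem hSf
  exact hmap ▸ hy

end IsCauchyPair

end CauchySubset

/-! ### Local solvability from a Cauchy causal function. -/

section CauchyFunction

variable {E : Type*} [NormedAddCommGroup E] [NormedSpace ℝ E] [FiniteDimensional ℝ E]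
  {M : Type*} [TopologicalSpace M] [ChartedSpace E M] [IsManifold 𝓘(ℝ, E) ∞ M]
  {C : Set (TangentBundle 𝓘(ℝ, E) M)} {τ : M → ℝ}

theorem IsCauchyCausalFunction.isLocallySolvable [T2Space M] [SecondCountableTopology M]
    (hτ : IsCauchyCausalFunction C τ) (hC : IsChartClosed C) : IsLocallySolvable C := by
  intro x hx
  have : Nonempty M := ⟨x⟩
  obtain ⟨B, hB⟩ := exists_boxes hC
  obtain ⟨B', hB'⟩ := exists_boxes hC.reversed
  obtain ⟨I, γ, hγ, hγ0⟩ := exists_isRay hC hB hx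
  obtain ⟨J, η, hη, hη0⟩ := exists_isRay hC.reversed hB' (x := x) (by rwa [domain_reversed])
  obtain ⟨Γ, hΓ, h1, -⟩ := exists_isInextensible hC hγ hη (hγ0.trans hη0.symm)
  have hmem : (0 : ℝ) ∈ -J ∪ I := Or.inr hγ.isLeast.1
  have h0 : Γ 0 = x := (h1 0 hγ.isLeast.1).trans hγ0
  have hmono := hτ.1.2 _ _ hΓ.1
  -- The inextensible curve through `x` might a priori end at `x`. Since `τ` attains `τ x - 1` and
  -- `τ x + 1` along it, monotonicity gives times on both sides of `0`.
  obtain ⟨s, hsm, hs⟩ := hτ.2 _ _ hΓ (mem_univ (τ x - 1))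
  obtain ⟨t, htm, ht⟩ := hτ.2 _ _ hΓ (mem_univ (τ x + 1))
  simp only at hs ht
  have hs0 : s < 0 := by
    by_contra! hle
    have := hmono hmem hsm hle
    simp only [h0, hs] at this
    linarith
  have ht0 : 0 < t := by
    by_contra! hle
    have := hmono htm hmem hle
    simp only [h0, ht] at this
    linarith
  have hε : 0 < min (-s) t := lt_min (neg_pos.2 hs0) ht0
  set ε := min (-s) t
  have hε1 : ε ≤ -s := min_le_left _ _
  have hε2 : ε ≤ t := min_le_right _ _
  have hsub : Ioo (-ε) ε ⊆ -J ∪ I := fun u hu =>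
    hΓ.1.ordConnected.out hsm htm ⟨by linarith [hu.1], by linarith [hu.2]⟩
  have hr := (hΓ.1.restrict hC hsub ordConnected_Ioo (nonempty_Ioo.2 (by linarith))).comp_affine
    (C' := C) (β := 0) hε.ne' fun y v hv => hC.smul_mem y ε hε v hv
  have hpre : (fun u => ε * u + 0) ⁻¹' Ioo (-ε) ε = Ioo (-1) 1 := by
    ext u
    simp only [mem_preimage, mem_Ioo, add_zero]
    constructor <;> rintro ⟨h1, h2⟩ <;> constructor <;> nlinarith
  rw [hpre] at hr
  refine ⟨_, hr, by simpa using h0, ?_⟩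
  by_contra! hconst
  have hsub' : Icc (0 : ℝ) (1 / 2) ⊆ Ioo (-1) 1 := fun u hu =>
    ⟨by linarith [hu.1], by linarith [hu.2]⟩
  exact hr.not_constant hC (a := 0) (b := 1 / 2) (by norm_num) hsub' fun u hu =>
    hconst u (hsub' hu) 0 (by norm_num)

end CauchyFunction

end ConeField

theorem mainTheorem7 {E : Type*} [NormedAddCommGroup E] [NormedSpace ℝ E] [FiniteDimensional ℝ E]
    {M : Type*} [TopologicalSpace M] [T2Space M] [SecondCountableTopology M] [ChartedSpace E M]
    [IsManifold 𝓘(ℝ, E) ∞ M]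
    (C : Set (TangentBundle 𝓘(ℝ, E) M)) (hC : ConeField.IsClosedConeField C) :
    (ConeField.IsLocallySolvable C → (∃ H : Set M, ConeField.IsCauchySubset C H) →
      ConeField.IsGloballyHyperbolic C) ∧
    ((∃ τ : M → ℝ, ConeField.IsCauchyCausalFunction C τ) →
      ConeField.IsGloballyHyperbolic C) := by
  have hC' := hC.isChartClosed
  have key : ConeField.IsLocallySolvable C → (∃ H : Set M, ConeField.IsCauchySubset C H) →
      ConeField.IsGloballyHyperbolic C := by
    rintro hs ⟨H, hH⟩
    obtain ⟨P, F, h⟩ := hH.exists_isCauchyPair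
    exact ⟨⟨h.isCausal hC' hs, fun K K' hK hK' => h.isCompact_inter hC' hs hK hK'⟩, hs⟩
  refine ⟨key, ?_⟩
  rintro ⟨τ, hτ⟩
  exact key (hτ.isLocallySolvable hC') ⟨_, hτ.isCauchySubset⟩
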